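/- Let $K$ be a field and $\mathbb{N}^*=\{1,2,3,\dots\}$. **NQSh algebras.** A (nonunital) noncommutative quasi-shuffle (NQSh, or tridendriform) algebra is a $K$-vector space $A$ with three bilinear products $\prec,\succ,\bullet$ such that, with $x\star y:=x\prec y+x\succ y+x\bullet y$, for all $x,y,z\in A$: $(x\prec y)\prec z=x\prec(y\star z)$, $(x\succ y)\prec z=x\succ(y\prec z)$, $(x\star y)\succ z=x\succ(y\succ z)$, $(x\prec y)\bullet z=x\bullet(y\succ z)$, $(x\succ y)\bullet z=x\succ(y\bullet z)$, $(x\bullet y)\prec z=x\bullet(y\prec z)$, $(x\bullet y)\bullet z=x\bullet(y\bullet z)$. Morphisms are the linear maps that respect the three products. **Trees.** A decorated Schröder tree of degree $n$ is a reduced planar rooted tree with $n+1$ leaves whose $n$ spaces between consecutive leaves are decorated by elements of $\mathbb{N}^*$; $|$ denotes the tree of degree $0$. For $k\ge2$, $t_1\vee_{d_1}\cdots\vee_{d_{k-1}}t_k$ is the tree obtained by grafting $t_1,\dots,t_k$ on a common root, the space between $t_i$ and $t_{i+1}$ being decorated by $d_i$. Let $NQSh(\mathbb{N}^*)$ be the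 vector space with basis the decorated Schröder trees of degree $\ge 1$, with the products defined inductively, for $t=t_1\vee_{d_1}\cdots\vee_{d_{k-1}}t_k$ and $t'=t'_1\vee_{d'_1}\cdots\vee_{d'_{l-1}}t'_l$, by $$t\prec t'=t_1\vee_{d_1}\cdots\vee_{d_{k-2}}t_{k-1}\vee_{d_{k-1}}(t_k\star t'),\qquad t\succ t'=(t\star t'_1)\vee_{d'_1}t'_2\vee_{d'_2}\cdots\vee_{d'_{l-1}}t'_l,$$ $$t\bullet t'=t_1\vee_{d_1}\cdots\vee_{d_{k-1}}(t_k\star t'_1)\vee_{d'_1}\cdots\vee_{d'_{l-1}}t'_l,$$ where $\star=\prec+\succ+\bullet$, $|$ is a unit for $\star$, and grafting is extended multilinearly. **Words.** A word over $\mathbb{N}^*$ is packed if its set of letters is $\{1,\dots,m\}$ for some $m\ge0$. A decorated packed word $(\sigma,d)$ of length $k$ is a packed word $\sigma=\sigma(1)\cdots\sigma(k)$ with a map $d:\{1,\dots,k\}\to\mathbb{N}^*$. $\mathrm{Pack}$ replaces each letter of a word by its rank among the letters of that word, and keeps decorations. Let $\mathbf{QSh}^d_+$ be the vector space with basis the nonempty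 decorated packed words. For $(\sigma,d)$ of length $k$ and $(\tau,e)$ of length $l$, $(\sigma,d)\prec(\tau,e)$ (resp. $\succ$, resp. $\bullet$) is the sum of the words $(u,(d(1),\dots,d(k),e(1),\dots,e(l)))$ over the packed words $u$ of length $k+l$ with $\mathrm{Pack}(u(1)\cdots u(k))=\sigma$, $\mathrm{Pack}(u(k+1)\cdots u(k+l))=\tau$ and $\min(u(1)\cdots u(k))<\min(u(k+1)\cdots u(k+l))$ (resp. $>$, resp. $=$). **The map $\Omega$.** Define $\varrho$ from decorated packed words to decorated Schröder trees by sending the empty word to $|$ and, if $\sigma^{-1}(1)=\{i_1<\dots<i_k\}$ with $k\ge1$, by $\varrho(\sigma,d)=\varrho(w_1)\vee_{d(i_1)}\cdots\vee_{d(i_k)}\varrho(w_{k+1})$, where $w_1,\dots,w_{k+1}$ are the packings of the $k+1$ (possibly empty) decorated pieces into which $(\sigma,d)$ is cut by removing the positions $i_1,\dots,i_k$. For a tree $t$ of degree $\ge 1$ put $\Omega(t)=\sum_{\varrho(\sigma,d)=t}(\sigma,d)$ (a finite sum), and extend $\Omega$ linearly to $NQSh(\mathbb{N}^*)\to\mathbf{QSh}^d_+$.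 **Theorem.** $\mathbf{QSh}^d_+$ is an NQSh algebra, $NQSh(\mathbb{N}^*)$ is the free NQSh algebra on the trees of degree one decorated by $d$, $d\in\mathbb{N}^*$, and $\Omega: NQSh(\mathbb{N}^*)\to\mathbf{QSh}^d_+$ is an injective morphism of NQSh algebras. Consequently $\mathbf{QDesc}$, the NQSh subalgebra of $\mathbf{QSh}^d_+$ generated by the words $\binom{1}{d}$ of length one, $d\ge1$, is the free NQSh algebra on these elements, and $\Omega$ induces an isomorphism from $NQSh(\mathbb{N}^*)$ onto $\mathbf{QDesc}$. -/

import Mathlib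

universe u v

namespace QuasiShuffle

/-! ### Noncommutative quasi-shuffle (tridendriform) algebras -/

/-- Three bilinear products `≺`, `≻`, `•` on a `K`-module, without any axiom. -/
structure TriOps (K : Type*) (A : Type*) [Field K] [AddCommGroup A] [Module K A] where
  prec : A →ₗ[K] A →ₗ[K] A
  succ : A →ₗ[K] A →ₗ[K] A
  bul : A →ₗ[K] A →ₗ[K] A

section Algebra

variable {K : Type*} [Field K] {A : Type*} [AddCommGroup A] [Module K A]
  {B : Type*} [AddCommGroup B] [Module K B]

/-- The product `x ⋆ y = x ≺ y + x ≻ y + x • y`. -/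
def TriOps.star (o : TriOps K A) (x y : A) : A := o.prec x y + o.succ x y + o.bul x y

/-- The axioms of a (nonunital) noncommutative quasi-shuffle algebra. -/
structure IsNQSh (o : TriOps K A) : Prop where
  prec_prec : ∀ x y z, o.prec (o.prec x y) z = o.prec x (o.star y z)
  succ_prec : ∀ x y z, o.prec (o.succ x y) z = o.succ x (o.prec y z)
  star_succ : ∀ x y z, o.succ (o.star x y) z = o.succ x (o.succ y z)
  prec_bul : ∀ x y z, o.bul (o.prec x y) z = o.bul x (o.succ y z)
  succ_bul : ∀ x y z, o.bul (o.succ x y) z = o.succ x (o.bul y z)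
  bul_prec : ∀ x y z, o.prec (o.bul x y) z = o.bul x (o.prec y z)
  bul_assoc : ∀ x y z, o.bul (o.bul x y) z = o.bul x (o.bul y z)

/-- A linear map compatible with the three products. -/
structure IsTriHom (o : TriOps K A) (o' : TriOps K B) (f : A →ₗ[K] B) : Prop where
  map_prec : ∀ x y, f (o.prec x y) = o'.prec (f x) (f y)
  map_succ : ∀ x y, f (o.succ x y) = o'.succ (f x) (f y)
  map_bul : ∀ x y, f (o.bul x y) = o'.bul (f x) (f y)

/-- A subspace that is closed under the three products. -/
structure TriOps.Closed (o : TriOps K A) (S : Submodule K A) : Prop where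
  prec_mem : ∀ {x y}, x ∈ S → y ∈ S → o.prec x y ∈ S
  succ_mem : ∀ {x y}, x ∈ S → y ∈ S → o.succ x y ∈ S
  bul_mem : ∀ {x y}, x ∈ S → y ∈ S → o.bul x y ∈ S

/-- The three products restricted to a closed subspace. -/
def TriOps.restrict (o : TriOps K A) (S : Submodule K A) (h : o.Closed S) : TriOps K S where
  prec := LinearMap.mk₂ K (fun x y => ⟨o.prec x y, h.prec_mem x.2 y.2⟩)
    (by intros; ext; simp) (by intros; ext; simp) (by intros; ext; simp) (by intros; ext; simp)
  succ := LinearMap.mk₂ K (fun x y => ⟨o.succ x y, h.succ_mem x.2 y.2⟩)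
    (by intros; ext; simp) (by intros; ext; simp) (by intros; ext; simp) (by intros; ext; simp)
  bul := LinearMap.mk₂ K (fun x y => ⟨o.bul x y, h.bul_mem x.2 y.2⟩)
    (by intros; ext; simp) (by intros; ext; simp) (by intros; ext; simp) (by intros; ext; simp)

/-- The smallest subspace that contains `X` and is closed under the three products. -/
def TriOps.generated (o : TriOps K A) (X : Set A) : Submodule K A :=
  sInf {S | X ⊆ S ∧ o.Closed S}

theorem TriOps.subset_generated (o : TriOps K A) (X : Set A) : X ⊆ o.generated X := by
  intro x hx
  simp only [generated, SetLike.mem_coe, Submodule.mem_sInf, Set.mem_ofPred_eq]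
  exact fun S hS => hS.1 hx

theorem TriOps.closed_generated (o : TriOps K A) (X : Set A) : o.Closed (o.generated X) where
  prec_mem hx hy := by
    simp only [generated, Submodule.mem_sInf, Set.mem_ofPred_eq] at *
    exact fun S hS => hS.2.prec_mem (hx S hS) (hy S hS)
  succ_mem hx hy := by
    simp only [generated, Submodule.mem_sInf, Set.mem_ofPred_eq] at *
    exact fun S hS => hS.2.succ_mem (hx S hS) (hy S hS)
  bul_mem hx hy := by
    simp only [generated, Submodule.mem_sInf, Set.mem_ofPred_eq] at *
    exact fun S hS => hS.2.bul_mem (hx S hS) (hy S hS)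

end Algebra

/-- `(A, ≺, ≻, •)` is the free noncommutative quasi-shuffle algebra on the family `ι : D → A`:
it is one, and every map from `D` to one (in the universe `w`) extends along `ι` to a unique
morphism. -/
def IsFreeNQSh.{w, a, b, c} {K : Type a} [Field K] {A : Type b} [AddCommGroup A] [Module K A]
    {D : Type c} (o : TriOps K A) (ι : D → A) : Prop :=
  IsNQSh o ∧ ∀ (C : Type w) [AddCommGroup C] [Module K C] (oC : TriOps K C), IsNQSh oC →
    ∀ g : D → C, ∃! f : A →ₗ[K] C, IsTriHom o oC f ∧ ∀ d, f (ι d) = g d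

section Linear

variable (K : Type*) [Field K] {ι κ μ : Type*}

/-- The sum, in the vector space with basis `μ`, of the elements of a finite subset of `μ`. -/
noncomputable def sumOver (S : Set μ) (h : S.Finite) : μ →₀ K :=
  ∑ a ∈ h.toFinset, Finsupp.single a 1

/-- The bilinear map with prescribed values on the pairs of basis elements. -/
noncomputable def bilin (f : ι → κ → (μ →₀ K)) : (ι →₀ K) →ₗ[K] (κ →₀ K) →ₗ[K] (μ →₀ K) :=
  Finsupp.linearCombination K fun i => Finsupp.linearCombination K (f i)

end Linear

/-! ### Decorated Schröder trees -/

/-- Reduced planar rooted trees whose spaces between the leaves are decorated by `D`. The tree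
`t₁ ∨_{d₁} t₂ ∨_{d₂} ⋯ ∨_{d_{k-1}} t_k` with `k ≥ 2` is
`node t₁ d₁ [(t₂, d₂), …, (t_{k-1}, d_{k-1})] t_k`. -/
inductive SchTree (D : Type*) where
  | leaf : SchTree D
  | node : SchTree D → D → List (SchTree D × D) → SchTree D → SchTree D

/-- The decorations of a tree, read from left to right. -/
def SchTree.dec {D : Type*} : SchTree D → List D
  | leaf => []
  | node a d l b =>
      a.dec ++ d :: ((l.attach.map fun q => q.1.1.dec ++ [q.1.2]).flatten ++ b.dec)
termination_by t => sizeOf t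
decreasing_by
  · simp only [node.sizeOf_spec]; omega
  · have h1 := List.sizeOf_lt_of_mem q.2
    have h2 : sizeOf q.1 = 1 + sizeOf q.1.1 + sizeOf q.1.2 := by cases q.1; simp
    simp only [node.sizeOf_spec]; omega
  · simp only [node.sizeOf_spec]; omega

/-- Decorated Schröder trees of degree at least one. -/
abbrev NTree (D : Type*) : Type _ := {t : SchTree D // t ≠ SchTree.leaf}

/-- The tree of degree one decorated by `d`. -/
def corolla {D : Type*} (d : D) : NTree D :=
  ⟨SchTree.node SchTree.leaf d [] SchTree.leaf, by simp⟩

section TreeProducts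

variable (K : Type*) [Field K] {D : Type*}

/-- The product `⋆` of two trees, the tree with one leaf being its unit. The three terms
of the last case are `t ≺ t'`, `t ≻ t'` and `t • t'`. -/
noncomputable def SchTree.star : SchTree D → SchTree D → (SchTree D →₀ K)
  | leaf, t => Finsupp.single t 1
  | node a d l b, leaf => Finsupp.single (node a d l b) 1
  | node a d l b, node a' d' l' b' =>
      (SchTree.star b (node a' d' l' b')).mapDomain (fun s => node a d l s)
      + (SchTree.star (node a d l b) a').mapDomain (fun s => node s d' l' b')
      + (SchTree.star b a').mapDomain (fun s => node a d (l ++ (s, d') :: l') b')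
termination_by t t' => sizeOf t + sizeOf t'

/-- `t ≺ t' = t₁ ∨ ⋯ ∨ t_{k-1} ∨ (t_k ⋆ t')`. -/
noncomputable def treePrec : NTree D → NTree D → (NTree D →₀ K)
  | ⟨SchTree.leaf, h⟩, _ => absurd rfl h
  | ⟨SchTree.node a d l b, _⟩, t' =>
      (SchTree.star K b t'.1).mapDomain fun s => ⟨SchTree.node a d l s, by simp⟩

/-- `t ≻ t' = (t ⋆ t'₁) ∨ t'₂ ∨ ⋯ ∨ t'_l`. -/
noncomputable def treeSucc : NTree D → NTree D → (NTree D →₀ K)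
  | _, ⟨SchTree.leaf, h⟩ => absurd rfl h
  | t, ⟨SchTree.node a' d' l' b', _⟩ =>
      (SchTree.star K t.1 a').mapDomain fun s => ⟨SchTree.node s d' l' b', by simp⟩

/-- `t • t' = t₁ ∨ ⋯ ∨ t_{k-1} ∨ (t_k ⋆ t'₁) ∨ t'₂ ∨ ⋯ ∨ t'_l`. -/
noncomputable def treeBul : NTree D → NTree D → (NTree D →₀ K)
  | ⟨SchTree.leaf, h⟩, _ => absurd rfl h
  | _, ⟨SchTree.leaf, h⟩ => absurd rfl h
  | ⟨SchTree.node a d l b, _⟩, ⟨SchTree.node a' d' l' b', _⟩ =>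
      (SchTree.star K b a').mapDomain fun s =>
        ⟨SchTree.node a d (l ++ (s, d') :: l') b', by simp⟩

/-- The three products on the vector space `NQSh(D)` with basis the decorated Schröder trees
of degree at least one. -/
noncomputable def treeOps (D : Type*) : TriOps K (NTree D →₀ K) where
  prec := bilin K (treePrec K)
  succ := bilin K (treeSucc K)
  bul := bilin K (treeBul K)

end TreeProducts

/-! ### Decorated packed words -/

/-- A word over the positive integers is packed if its set of letters is `{1, …, m}`
for some `m ≥ 0`. -/
def IsPacked (u : List ℕ) : Prop := ∃ m : ℕ, ∀ i, i ∈ u ↔ 1 ≤ i ∧ i ≤ m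

/-- The rank of `a` among the letters of `u`. -/
def rank (u : List ℕ) (a : ℕ) : ℕ := (u.toFinset.filter (· ≤ a)).card

/-- The packing of a decorated word: every letter is replaced by its rank, and the decorations
are kept. -/
def pack {D : Type*} (w : List (ℕ × D)) : List (ℕ × D) :=
  w.map fun x => (rank (w.map Prod.fst) x.1, x.2)

theorem rank_lt_rank {u : List ℕ} {a b : ℕ} (hb : b ∈ u) (h : a < b) : rank u a < rank u b := by
  refine Finset.card_lt_card ⟨?_, ?_⟩
  · intro i; simp only [Finset.mem_filter]; exact fun hi => ⟨hi.1, hi.2.trans h.le⟩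
  · intro hs
    have := hs (show b ∈ u.toFinset.filter (· ≤ b) by simp [hb])
    simp only [Finset.mem_filter] at this
    omega

theorem rank_injOn (u : List ℕ) : Set.InjOn (rank u) {a | a ∈ u} := by
  intro a ha b hb h
  rcases lt_trichotomy a b with hab | hab | hab
  · exact absurd h (rank_lt_rank hb hab).ne
  · exact hab
  · exact absurd h (rank_lt_rank ha hab).ne'

theorem image_rank (u : List ℕ) :
    u.toFinset.image (rank u) = Finset.Icc 1 u.toFinset.card := by
  refine Finset.eq_of_subset_of_card_le ?_ ?_
  · intro i hi
    obtain ⟨a, ha, rfl⟩ := Finset.mem_image.1 hi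
    refine Finset.mem_Icc.2 ⟨Finset.card_pos.2 ⟨a, by simpa using ha⟩,
      Finset.card_le_card (Finset.filter_subset _ _)⟩
  · rw [Finset.card_image_of_injOn (by simpa using rank_injOn u)]
    simp

theorem isPacked_pack {D : Type*} (w : List (ℕ × D)) :
    IsPacked ((pack w).map Prod.fst) := by
  refine ⟨(w.map Prod.fst).toFinset.card, fun i => ?_⟩
  rw [← Finset.mem_Icc, ← image_rank]
  simp [pack]

theorem length_pack {D : Type*} (w : List (ℕ × D)) : (pack w).length = w.length := by
  simp [pack]

theorem snd_pack {D : Type*} (w : List (ℕ × D)) :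
    (pack w).map Prod.snd = w.map Prod.snd := by
  simp [pack]

theorem le_length_of_isPacked {u : List ℕ} (h : IsPacked u) {a : ℕ} (ha : a ∈ u) :
    a ≤ u.length := by
  obtain ⟨m, hm⟩ := h
  have h1 : Finset.Icc 1 m ⊆ u.toFinset := fun i hi => by
    simpa [hm] using hi
  have h2 := (Finset.card_le_card h1).trans u.toFinset_card_le
  have h3 := ((hm a).1 ha).2
  simp at h2
  omega

/-- Nonempty packed words decorated by `D`: the word with columns `(σ(i), d(i))` is the list of
these pairs. -/
abbrev NWord (D : Type*) : Type _ :=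
  {w : List (ℕ × D) // w ≠ [] ∧ IsPacked (w.map Prod.fst)}

/-- The word of length one with the letter `1`, decorated by `d`. -/
def letter {D : Type*} (d : D) : NWord D :=
  ⟨[(1, d)], by simp, 1, fun i => by simp; omega⟩

theorem finite_dec {D : Type*} (ds : List D) :
    {v : NWord D | v.1.map Prod.snd = ds}.Finite := by
  have h : (((fun l : List (Fin (ds.length + 1)) => (l.map Fin.val).zip ds) ''
      {l | l.length = ds.length})).Finite :=
    (List.finite_length_eq (Fin (ds.length + 1)) ds.length).image _
  refine (h.preimage Subtype.val_injective.injOn).subset ?_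
  rintro ⟨v, hv, hp⟩ (rfl : v.map Prod.snd = ds)
  have hb : ∀ a ∈ v.map Prod.fst, a < (v.map Prod.snd).length + 1 := fun a ha => by
    have := le_length_of_isPacked hp ha
    simp only [List.length_map] at *
    omega
  refine ⟨(v.map Prod.fst).attach.map fun a => ⟨a.1, hb a.1 a.2⟩, by simp, ?_⟩
  simp only [List.map_map, Function.comp_def]
  rw [List.attach_map_subtype_val]
  exact (List.zip_of_prod rfl rfl).symm

section WordProducts

variable (K : Type*) [Field K] {D : Type*}

/-- The words `v` of length `k + l` (`k`, `l` the lengths of `w`, `w'`) whose first `k` columns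
pack to `w`, whose last `l` columns pack to `w'`, and such that the smallest letters of the two
parts are related by `r`. -/
def wordSet (r : WithTop ℕ → WithTop ℕ → Prop) (w w' : NWord D) : Set (NWord D) :=
  {v | pack (v.1.take w.1.length) = w.1 ∧ pack (v.1.drop w.1.length) = w'.1 ∧
    r ((v.1.take w.1.length).map Prod.fst).minimum ((v.1.drop w.1.length).map Prod.fst).minimum}

theorem wordSet_finite (r : WithTop ℕ → WithTop ℕ → Prop) (w w' : NWord D) :
    (wordSet r w w').Finite := by
  refine (finite_dec (w.1.map Prod.snd ++ w'.1.map Prod.snd)).subset ?_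
  rintro v ⟨h1, h2, -⟩
  change v.1.map Prod.snd = _
  have e1 := congrArg (List.map Prod.snd) h1
  have e2 := congrArg (List.map Prod.snd) h2
  rw [snd_pack] at e1 e2
  rw [← e1, ← e2, ← List.map_append, List.take_append_drop]

/-- The three products on the vector space with basis the nonempty decorated packed words. -/
noncomputable def wordOps (D : Type*) : TriOps K (NWord D →₀ K) where
  prec := bilin K fun w w' => sumOver K (wordSet (· < ·) w w') (wordSet_finite _ w w')
  succ := bilin K fun w w' => sumOver K (wordSet (· > ·) w w') (wordSet_finite _ w w')
  bul := bilin K fun w w' => sumOver K (wordSet (· = ·) w w') (wordSet_finite _ w w')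

end WordProducts

/-! ### The map from decorated packed words to decorated Schröder trees -/

section Rho

variable {D : Type*}

/-- Cutting a decorated word at the positions `i₁ < ⋯ < i_k` of the letter `1`: the pieces
`w₁, …, w_k` before these positions, each with the decoration `d(i_j)` of the `1` that follows
it, and the last piece `w_{k+1}`. -/
def cut : List (ℕ × D) → List (List (ℕ × D) × D) × List (ℕ × D)
  | [] => ([], [])
  | x :: w =>
      if x.1 = 1 then (([], x.2) :: (cut w).1, (cut w).2)
      else match cut w with
        | ([], r) => ([], x :: r)
        | ((p, e) :: ps, r) => ((x :: p, e) :: ps, r)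

theorem dec_cut (w : List (ℕ × D)) :
    w.map Prod.snd = ((cut w).1.map fun q => q.1.map Prod.snd ++ [q.2]).flatten
      ++ (cut w).2.map Prod.snd := by
  induction w with
  | nil => simp [cut]
  | cons x w ih =>
    rw [cut]
    split_ifs with h
    · simp [ih]
    · split <;> rename_i heq <;> simp [ih, heq]

theorem cut_ne_nil {w : List (ℕ × D)} (h : 1 ∈ w.map Prod.fst) : (cut w).1 ≠ [] := by
  induction w with
  | nil => simp at h
  | cons x w ih =>
    rw [cut]
    split_ifs with hx
    · simp
    · have h' : 1 ∈ w.map Prod.fst := by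
        rw [List.map_cons, List.mem_cons] at h
        exact h.resolve_left (Ne.symm hx)
      split <;> rename_i heq
      · exact absurd (by rw [heq]) (ih h')
      · simp

theorem length_cut (w : List (ℕ × D)) :
    w.length = ((cut w).1.map fun q => q.1.length + 1).sum + (cut w).2.length := by
  induction w with
  | nil => simp [cut]
  | cons x w ih =>
    rw [cut]
    split_ifs with h
    · simp [ih]; omega
    · split <;> rename_i heq <;> simp [ih, heq] <;> omega

/-- The map `ϱ`. On a packed word there is no letter `1` only if the word is empty. -/
def rho (w : List (ℕ × D)) : SchTree D :=
  match h : cut w with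
  | ([], _) => SchTree.leaf
  | ((p, d) :: ps, r) =>
      SchTree.node (rho (pack p)) d
        (ps.attach.map fun q => (rho (pack q.1.1), q.1.2)) (rho (pack r))
termination_by w.length
decreasing_by
  all_goals
    have hl := length_cut w
    rw [h] at hl
    simp only [List.map_cons, List.sum_cons] at hl
    rw [length_pack]
  · omega
  · have := List.single_le_sum (l := ps.map fun q => q.1.length + 1) (by simp) _
      (List.mem_map_of_mem q.2)
    omega
  · omega

theorem rho_eq_leaf {w : List (ℕ × D)} {r} (h : cut w = ([], r)) : rho w = SchTree.leaf := by
  rw [rho]; split <;> simp_all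

theorem rho_eq_node {w : List (ℕ × D)} {p d ps r} (h : cut w = ((p, d) :: ps, r)) :
    rho w = SchTree.node (rho (pack p)) d (ps.map fun q => (rho (pack q.1), q.2))
      (rho (pack r)) := by
  rw [rho]
  split
  · simp_all
  · rename_i heq
    rw [h] at heq
    simp only [Prod.mk.injEq, List.cons.injEq] at heq
    obtain ⟨⟨⟨rfl, rfl⟩, rfl⟩, rfl⟩ := heq
    congr 1
    exact List.attach_map_val (f := fun q : List (ℕ × D) × D => (rho (pack q.1), q.2))

/-- The tree of a decorated packed word of length `n` has degree `n` and the same decorations. -/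
theorem dec_rho (w : List (ℕ × D)) (hw : IsPacked (w.map Prod.fst)) :
    (rho w).dec = w.map Prod.snd := by
  induction hn : w.length using Nat.strong_induction_on generalizing w with
  | _ n ih =>
    subst hn
    have key : ∀ v : List (ℕ × D), v.length < w.length →
        (rho (pack v)).dec = v.map Prod.snd := fun v hv => by
      rw [ih _ (by rwa [length_pack]) (pack v) (isPacked_pack v) rfl, snd_pack]
    rcases hc : cut w with ⟨_ | ⟨⟨p, d⟩, ps⟩, r⟩
    · rw [rho_eq_leaf hc, SchTree.dec]
      by_contra hne
      have h1 : 1 ∈ w.map Prod.fst := by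
        obtain ⟨m, hm⟩ := hw
        have : w ≠ [] := by rintro rfl; simp at hne
        obtain ⟨x, hx⟩ := List.exists_mem_of_ne_nil w this
        have := (hm x.1).1 (List.mem_map_of_mem hx)
        exact (hm 1).2 ⟨le_rfl, this.1.trans this.2⟩
      exact cut_ne_nil h1 (by rw [hc])
    · have hl := length_cut w
      rw [hc] at hl
      simp only [List.map_cons, List.sum_cons] at hl
      rw [rho_eq_node hc, SchTree.dec, dec_cut w, hc, key p (by omega), key r (by omega),
        List.attach_map_val (f := fun q : SchTree D × D => q.1.dec ++ [q.2]), List.map_map]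
      have : (ps.map ((fun q : SchTree D × D => q.1.dec ++ [q.2]) ∘
          fun q => (rho (pack q.1), q.2))) = ps.map fun q => q.1.map Prod.snd ++ [q.2] := by
        refine List.map_congr_left fun q hq => ?_
        have := List.single_le_sum (l := ps.map fun q => q.1.length + 1) (by simp) _
          (List.mem_map_of_mem hq)
        simp only [Function.comp_apply]
        rw [key q.1 (by omega)]
      rw [this]
      simp

/-- The set of decorated packed words with a given tree. -/
def fiber (t : NTree D) : Set (NWord D) := {w | rho w.1 = t.1}

theorem fiber_finite (t : NTree D) : (fiber t).Finite := by
  refine (finite_dec t.1.dec).subset ?_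
  intro w hw
  change w.1.map Prod.snd = t.1.dec
  rw [← dec_rho w.1 w.2.2, show rho w.1 = t.1 from hw]

end Rho

section Omega

variable (K : Type*) [Field K]

/-- The linear map `Ω`, which sends a tree `t` to the sum of the decorated packed words `w` with
`ϱ(w) = t`. -/
noncomputable def Omega (D : Type*) : (NTree D →₀ K) →ₗ[K] (NWord D →₀ K) :=
  Finsupp.linearCombination K fun t => sumOver K (fiber t) (fiber_finite t)

/-- The subalgebra generated by the words of length one. -/
noncomputable def QDesc (D : Type*) : Submodule K (NWord D →₀ K) :=
  (wordOps K D).generated (Set.range fun d => Finsupp.single (letter d) 1)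

/-- The three products of `QDesc`. -/
noncomputable def qdescOps (D : Type*) : TriOps K (QDesc K D) :=
  (wordOps K D).restrict (QDesc K D) ((wordOps K D).closed_generated _)

/-- The generators of `QDesc`. -/
noncomputable def qdescGen {D : Type*} (d : D) : QDesc K D :=
  ⟨Finsupp.single (letter d) 1, (wordOps K D).subset_generated _ ⟨d, rfl⟩⟩

end Omega

end QuasiShuffle

namespace QuasiShuffle

/-! ### Packing and strictly increasing relabellings -/

section Pack

variable {D : Type*}

/-! The coefficient of a word `v` in a product of two word polynomials, the first homogeneous of
degree `k`, is obtained by cutting `v` after `k` letters: it is the product of the coefficients of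
the two packed pieces if their minima satisfy `<`, `>` or `=`, and zero otherwise (`coeff_wordOp`).
In an iterated product, the two bracketings cut `v` into the same three factors, so each NQSh axiom
becomes an equivalence between order conditions on three minima `a`, `b`, `c` (`wordOp_assoc`).

In any NQSh algebra `C` with chosen elements `g d`, a tree must be sent to the expression obtained
by peeling off its branches: `a ∨_d b` to `(a ≻ g d) ≺ b`, and `a ∨_d c ∨_e ⋯` to `(a ≻ g d) • (c
∨_e ⋯)`, where the leaf acts as a unit. Induction along the recursion defining `⋆` on trees shows
that this evaluation respects the products (`IsNQSh.evalLin_star`, `IsNQSh.isTriHom_lift`). Only the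
axioms of `C` enter, never those of the tree algebra.

For the word algebra and the one-letter words, the evaluation is `Ω`. Indeed, the first occurrence
of the minimum of a word separates the first branch of its tree from the rest, and whether the
minimum occurs again decides between `≺` and `•` (`coeffU_evalTree`, `Omega_eq_lift`). Hence `Ω` is
a morphism. It is injective because its fibres over trees are disjoint and nonempty (`coeff_Omega`,
`exists_rho_pack`).

The axioms for trees then follow by pulling back along `Ω`. The evaluation gives existence in the
universal property, and generation by corollas gives uniqueness. Since corollas go to one-letter
words, the image of `Ω` is exactly `QDesc`. -/

theorem rank_map {u : List ℕ} {f : ℕ → ℕ} (hf : StrictMonoOn f {a | a ∈ u}) {a : ℕ}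
    (ha : a ∈ u) : rank (u.map f) (f a) = rank u a := by
  unfold rank
  rw [← Finset.card_image_of_injOn (s := u.toFinset.filter (· ≤ a)) (f := f)]
  · congr 1
    ext b
    simp only [Finset.mem_filter, List.mem_toFinset, List.mem_map, Finset.mem_image]
    constructor
    · rintro ⟨⟨c, hc, rfl⟩, h⟩
      exact ⟨c, ⟨hc, (hf.le_iff_le hc ha).1 h⟩, rfl⟩
    · rintro ⟨c, ⟨hc, h⟩, rfl⟩
      exact ⟨⟨c, hc, rfl⟩, (hf.le_iff_le hc ha).2 h⟩
  · intro x hx y hy h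
    simp only [Finset.coe_filter, List.mem_toFinset, Set.mem_ofPred_eq] at hx hy
    exact hf.injOn hx.1 hy.1 h

/-- Relabelling the letters of a decorated word. -/
def relabel (f : ℕ → ℕ) (w : List (ℕ × D)) : List (ℕ × D) := w.map fun x => (f x.1, x.2)

theorem pack_eq_relabel (w : List (ℕ × D)) : pack w = relabel (rank (w.map Prod.fst)) w := rfl

theorem map_fst_relabel (f : ℕ → ℕ) (w : List (ℕ × D)) :
    (relabel f w).map Prod.fst = (w.map Prod.fst).map f := by
  simp [relabel]

/-- Ranks depend only on the relative order of the letters. Monotonicity is required only on the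
letters present, so that rank functions themselves can serve as `f`. -/
theorem pack_relabel {f : ℕ → ℕ} {w : List (ℕ × D)}
    (hf : StrictMonoOn f {a | a ∈ w.map Prod.fst}) : pack (relabel f w) = pack w := by
  rw [pack_eq_relabel, pack_eq_relabel, map_fst_relabel]
  unfold relabel
  rw [List.map_map]
  refine List.map_congr_left fun x hx => ?_
  simp only [Function.comp_apply]
  rw [rank_map hf (List.mem_map_of_mem hx)]

theorem strictMonoOn_rank (u : List ℕ) : StrictMonoOn (rank u) {a | a ∈ u} :=
  fun _ _ _ hb h => rank_lt_rank hb h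

/-- Relabelling a part of a word by its rank in the whole word does not change its packing. -/
theorem pack_relabel_rank {u : List ℕ} {w : List (ℕ × D)} (h : w.map Prod.fst ⊆ u) :
    pack (relabel (rank u) w) = pack w :=
  pack_relabel ((strictMonoOn_rank u).mono fun _ ha => h ha)

theorem rank_of_isPacked {u : List ℕ} (hu : IsPacked u) {a : ℕ} (ha : a ∈ u) : rank u a = a := by
  obtain ⟨m, hm⟩ := hu
  have : u.toFinset.filter (· ≤ a) = Finset.Icc 1 a := by
    ext i
    have := (hm a).1 ha
    simp only [Finset.mem_filter, List.mem_toFinset, hm, Finset.mem_Icc]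
    omega
  rw [rank, this, Nat.card_Icc]
  omega

theorem pack_of_isPacked {w : List (ℕ × D)} (hw : IsPacked (w.map Prod.fst)) : pack w = w := by
  rw [pack]
  conv_rhs => rw [← List.map_id w]
  refine List.map_congr_left fun x hx => ?_
  rw [rank_of_isPacked hw (List.mem_map_of_mem hx)]
  rfl

theorem pack_pack (w : List (ℕ × D)) : pack (pack w) = pack w :=
  pack_of_isPacked (isPacked_pack w)

theorem pack_eq_nil {w : List (ℕ × D)} : pack w = [] ↔ w = [] := by simp [pack]

theorem pack_take_pack (k : ℕ) (w : List (ℕ × D)) : pack ((pack w).take k) = pack (w.take k) := by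
  rw [pack_eq_relabel w, relabel, ← List.map_take]
  refine pack_relabel_rank ?_
  rw [List.map_take]
  exact List.take_subset _ _

theorem pack_drop_pack (k : ℕ) (w : List (ℕ × D)) : pack ((pack w).drop k) = pack (w.drop k) := by
  rw [pack_eq_relabel w, relabel, ← List.map_drop]
  refine pack_relabel_rank ?_
  rw [List.map_drop]
  exact List.drop_subset _ _

/-- The smallest letter of a decorated word. -/
def minLetter (w : List (ℕ × D)) : WithTop ℕ := (w.map Prod.fst).minimum

/-- This form involves letters only and already accounts for empty words, whose minimum is `⊤`; its
invariance under increasing relabellings is immediate. -/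
theorem minLetter_lt_iff {w w' : List (ℕ × D)} :
    minLetter w < minLetter w' ↔ ∃ x ∈ w, ∀ y ∈ w', x.1 < y.1 := by
  constructor
  · intro h
    obtain ⟨m, hm⟩ := WithTop.ne_top_iff_exists.1 h.ne_top
    obtain ⟨x, hx, rfl⟩ := List.mem_map.1 (List.minimum_mem hm.symm)
    refine ⟨x, hx, fun y hy => ?_⟩
    have := List.minimum_le_of_mem' (List.mem_map_of_mem (f := Prod.fst) hy)
    rw [← hm] at h
    exact WithTop.coe_lt_coe.1 (h.trans_le this)
  · rintro ⟨x, hx, h⟩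
    refine lt_of_le_of_lt (List.minimum_le_of_mem' (List.mem_map_of_mem (f := Prod.fst) hx)) ?_
    by_cases ht : minLetter w' = ⊤
    · rw [ht]; exact WithTop.coe_lt_top _
    · obtain ⟨m, hm⟩ := WithTop.ne_top_iff_exists.1 ht
      obtain ⟨y, hy, rfl⟩ := List.mem_map.1 (List.minimum_mem hm.symm)
      rw [← hm]
      exact WithTop.coe_lt_coe.2 (h y hy)

theorem minLetter_relabel_lt_iff {f : ℕ → ℕ} {w w' : List (ℕ × D)} {s : Set ℕ}
    (hf : StrictMonoOn f s) (hw : ∀ x ∈ w, x.1 ∈ s) (hw' : ∀ x ∈ w', x.1 ∈ s) :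
    minLetter (relabel f w) < minLetter (relabel f w') ↔ minLetter w < minLetter w' := by
  simp only [minLetter_lt_iff, relabel, List.mem_map, exists_exists_and_eq_and,
    forall_exists_index, and_imp, forall_apply_eq_imp_iff₂]
  exact exists_congr fun x => and_congr_right fun hx => forall₂_congr fun y hy =>
    hf.lt_iff_lt (hw x hx) (hw' y hy)

theorem minLetter_append (w w' : List (ℕ × D)) :
    minLetter (w ++ w') = min (minLetter w) (minLetter w') := by
  induction w with
  | nil => simp [minLetter]
  | cons x w ih =>
    simp only [minLetter, List.cons_append, List.map_cons, List.minimum_cons] at *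
    rw [ih, min_assoc]

theorem minLetter_nil : minLetter ([] : List (ℕ × D)) = ⊤ := rfl

theorem minLetter_eq_top {w : List (ℕ × D)} : minLetter w = ⊤ ↔ w = [] := by
  simp [minLetter, List.minimum_eq_top]

theorem minLetter_lt_top {w : List (ℕ × D)} : minLetter w < ⊤ ↔ w ≠ [] := by
  rw [lt_top_iff_ne_top, ne_eq, minLetter_eq_top]

/-- Relations that only depend on the relative order of their arguments. -/
def OrderRel (r : WithTop ℕ → WithTop ℕ → Prop) : Prop :=
  ∀ a b c d, (a < b ↔ c < d) → (b < a ↔ d < c) → (r a b ↔ r c d)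

theorem orderRel_lt : OrderRel (· < ·) := fun _ _ _ _ h _ => h
theorem orderRel_gt : OrderRel (· > ·) := fun _ _ _ _ _ h => h
theorem orderRel_true : OrderRel fun _ _ => True := fun _ _ _ _ _ _ => Iff.rfl
theorem orderRel_eq : OrderRel (· = ·) := fun a b c d h h' => by
  change a = b ↔ c = d
  rw [eq_iff_le_not_lt, eq_iff_le_not_lt, ← not_lt, ← not_lt, h, h']

/-- Packing the whole word relabels both pieces by one and the same increasing function, so their
minima compare as before. Packing the pieces separately would destroy this. -/
theorem OrderRel.pack_take_drop {r : WithTop ℕ → WithTop ℕ → Prop} (hr : OrderRel r) (k : ℕ)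
    (w : List (ℕ × D)) :
    r (minLetter ((pack w).take k)) (minLetter ((pack w).drop k)) ↔
      r (minLetter (w.take k)) (minLetter (w.drop k)) := by
  have e1 : (pack w).take k = relabel (rank (w.map Prod.fst)) (w.take k) := by
    rw [pack_eq_relabel w, relabel, ← List.map_take]; rfl
  have e2 : (pack w).drop k = relabel (rank (w.map Prod.fst)) (w.drop k) := by
    rw [pack_eq_relabel w, relabel, ← List.map_drop]; rfl
  have h1 : ∀ x ∈ w.take k, x.1 ∈ {a | a ∈ w.map Prod.fst} := fun x hx =>
    List.mem_map_of_mem (List.take_subset _ _ hx)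
  have h2 : ∀ x ∈ w.drop k, x.1 ∈ {a | a ∈ w.map Prod.fst} := fun x hx =>
    List.mem_map_of_mem (List.drop_subset _ _ hx)
  rw [e1, e2]
  exact hr _ _ _ _ (minLetter_relabel_lt_iff (strictMonoOn_rank _) h1 h2)
    (minLetter_relabel_lt_iff (strictMonoOn_rank _) h2 h1)

end Pack

/-! ### The coefficients of the products of words -/

section Words

open scoped Classical in
theorem sumOver_apply (K : Type*) [Field K] {μ : Type*} (S : Set μ) (h : S.Finite) (a : μ) :
    sumOver K S h a = if a ∈ S then 1 else 0 := by
  rw [sumOver, Finsupp.finsetSum_apply]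
  simp [Finsupp.single_apply]

theorem bilin_single_single (K : Type*) [Field K] {ι κ μ : Type*} (f : ι → κ → (μ →₀ K))
    (i : ι) (j : κ) : bilin K f (Finsupp.single i 1) (Finsupp.single j 1) = f i j := by
  simp [bilin]

theorem bilin_add (K : Type*) [Field K] {ι κ μ : Type*} (f g : ι → κ → (μ →₀ K)) :
    bilin K (fun i j => f i j + g i j) = bilin K f + bilin K g := by
  ext i j : 4
  simp [bilin]

variable (K : Type*) [Field K] {D : Type*}

/-- The sum of the words with prescribed parts whose minima are related by `r`, extended
bilinearly. -/
noncomputable def wordOp (r : WithTop ℕ → WithTop ℕ → Prop) :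
    (NWord D →₀ K) →ₗ[K] (NWord D →₀ K) →ₗ[K] (NWord D →₀ K) :=
  bilin K fun w w' => sumOver K (wordSet r w w') (wordSet_finite _ w w')

/-- The packing of a nonempty decorated word. -/
def packWord (w : List (ℕ × D)) (h : w ≠ []) : NWord D :=
  ⟨pack w, fun h' => h (pack_eq_nil.1 h'), isPacked_pack w⟩

open scoped Classical in
/-- The coefficient of the packing of `w`, which is `0` if `w` is empty. -/
noncomputable def coeff (w : List (ℕ × D)) : (NWord D →₀ K) →ₗ[K] K :=
  if h : w ≠ [] then Finsupp.lapply (packWord w h) else 0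

variable {K}

theorem coeff_nil (X : NWord D →₀ K) : coeff K [] X = 0 := by simp [coeff]

theorem coeff_of_ne {w : List (ℕ × D)} (h : w ≠ []) (X : NWord D →₀ K) :
    coeff K w X = X (packWord w h) := by simp [coeff, h]

theorem coeff_pack (w : List (ℕ × D)) (X : NWord D →₀ K) : coeff K (pack w) X = coeff K w X := by
  by_cases h : w = []
  · subst h; rfl
  · rw [coeff_of_ne h, coeff_of_ne (fun h' => h (pack_eq_nil.1 h'))]
    congr 1
    exact Subtype.ext (pack_pack w)

theorem coeff_congr {w w' : List (ℕ × D)} (h : pack w = pack w') (X : NWord D →₀ K) :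
    coeff K w X = coeff K w' X := by
  rw [← coeff_pack w, h, coeff_pack]

theorem coeff_coe (w : NWord D) (X : NWord D →₀ K) : coeff K w.1 X = X w := by
  rw [coeff_of_ne w.2.1]
  congr 1
  exact Subtype.ext (pack_of_isPacked w.2.2)

theorem ext_coeff {X Y : NWord D →₀ K} (h : ∀ w, coeff K w X = coeff K w Y) : X = Y :=
  Finsupp.ext fun w => by rw [← coeff_coe, ← coeff_coe, h]

open scoped Classical in
theorem coeff_single (w : List (ℕ × D)) (v : NWord D) :
    coeff K w (Finsupp.single v 1) = if pack w = v.1 then 1 else 0 := by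
  by_cases h : w = []
  · subst h
    rw [coeff_nil, if_neg]
    exact fun h => v.2.1 h.symm
  · rw [coeff_of_ne h, Finsupp.single_apply]
    refine if_congr ?_ rfl rfl
    rw [Subtype.ext_iff, eq_comm]; rfl

/-- Being a combination of words of length `k`. -/
def Homog (k : ℕ) (X : NWord D →₀ K) : Prop :=
  ∀ w : List (ℕ × D), w.length ≠ k → coeff K w X = 0

theorem homog_single (w : NWord D) : Homog w.1.length (Finsupp.single w (1 : K)) := by
  intro v hv
  classical
  rw [coeff_single, if_neg]
  rintro h
  exact hv (by rw [← h, length_pack])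

open scoped Classical in
-- Once the length of `w` is fixed, `v` has a single possible cut, so it can occur only in the
-- product of the packings of its two pieces.
theorem wordOp_single_apply {r : WithTop ℕ → WithTop ℕ → Prop} (w : NWord D) (Y : NWord D →₀ K)
    (v : NWord D) :
    wordOp K r (Finsupp.single w 1) Y v =
      if r (minLetter (v.1.take w.1.length)) (minLetter (v.1.drop w.1.length)) then
        coeff K (v.1.take w.1.length) (Finsupp.single w 1) * coeff K (v.1.drop w.1.length) Y
      else 0 := by
  induction Y using Finsupp.induction_linear with
  | zero => simp
  | add Y Z hY hZ =>
    rw [map_add, Finsupp.add_apply, hY, hZ, map_add, mul_add]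
    split_ifs <;> simp
  | single w' c =>
    rw [← mul_one c, ← smul_eq_mul, ← Finsupp.smul_single, map_smul, map_smul, Finsupp.smul_apply,
      wordOp, bilin_single_single, sumOver_apply, coeff_single, coeff_single]
    simp only [wordSet, Set.mem_ofPred_eq, minLetter]
    by_cases h1 : pack (v.1.take w.1.length) = w.1 <;>
      by_cases h2 : pack (v.1.drop w.1.length) = w'.1 <;>
      by_cases h3 : r ((v.1.take w.1.length).map Prod.fst).minimum
        ((v.1.drop w.1.length).map Prod.fst).minimum <;>
      simp only [h1, h2, h3, and_self, and_false, false_and, if_true, if_false, smul_zero,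
        mul_zero, zero_mul, one_mul]

open scoped Classical in
-- Homogeneity makes every word in the support of `X` cut `v` at the same place; nothing is needed
-- on `Y`, which receives whatever remains.
theorem wordOp_apply {r : WithTop ℕ → WithTop ℕ → Prop} {k : ℕ} {X : NWord D →₀ K}
    (hX : Homog k X) (Y : NWord D →₀ K) (v : NWord D) :
    wordOp K r X Y v =
      if r (minLetter (v.1.take k)) (minLetter (v.1.drop k)) then
        coeff K (v.1.take k) X * coeff K (v.1.drop k) Y
      else 0 := by
  have e : X = ∑ w ∈ X.support, X w • Finsupp.single w (1 : K) := by
    conv_lhs => rw [← Finsupp.sum_single X]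
    simp [Finsupp.sum]
  have key : ∀ w ∈ X.support, w.1.length = k := fun w hw => by
    by_contra h
    exact Finsupp.mem_support_iff.1 hw (by rw [← coeff_coe, hX _ h])
  conv_lhs => rw [e]
  rw [map_sum, LinearMap.sum_apply, Finsupp.finsetSum_apply]
  conv_rhs => rw [e, map_sum, Finset.sum_mul]
  have : ∀ w ∈ X.support, (wordOp K r) (X w • Finsupp.single w 1) Y v =
      if r (minLetter (v.1.take k)) (minLetter (v.1.drop k)) then
        coeff K (v.1.take k) (X w • Finsupp.single w 1) * coeff K (v.1.drop k) Y
      else 0 := fun w hw => by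
    rw [map_smul, LinearMap.smul_apply, Finsupp.smul_apply, wordOp_single_apply, key w hw, map_smul]
    split_ifs <;> simp [mul_assoc]
  rw [Finset.sum_congr rfl this]
  split_ifs <;> simp

theorem coeff_wordOp {r : WithTop ℕ → WithTop ℕ → Prop} (hr : OrderRel r) {k : ℕ}
    {X : NWord D →₀ K} (hX : Homog k X) (Y : NWord D →₀ K) (w : List (ℕ × D))
    [Decidable (r (minLetter (w.take k)) (minLetter (w.drop k)))] :
    coeff K w (wordOp K r X Y) =
      if r (minLetter (w.take k)) (minLetter (w.drop k)) then
        coeff K (w.take k) X * coeff K (w.drop k) Y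
      else 0 := by
  by_cases h : w = []
  · subst h; simp [coeff_nil]
  · classical
    rw [coeff_of_ne h, wordOp_apply hX]
    simp only [packWord]
    rw [coeff_congr (pack_take_pack k w), coeff_congr (pack_drop_pack k w)]
    exact if_congr (hr.pack_take_drop k w) rfl rfl

theorem Homog.wordOp {r : WithTop ℕ → WithTop ℕ → Prop} (hr : OrderRel r) {k l : ℕ}
    {X Y : NWord D →₀ K} (hX : Homog k X) (hY : Homog l Y) : Homog (k + l) (wordOp K r X Y) := by
  intro w hw
  classical
  rw [coeff_wordOp hr hX]
  by_cases h : (w.take k).length = k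
  · rw [hY (w.drop k) (by simp only [List.length_take, List.length_drop] at *; omega)]
    simp
  · rw [hX _ h]; simp

/-- Two bilinear products on words defined by conditions on minima associate when the conditions
do. -/
theorem wordOp_assoc {r s r' s' : WithTop ℕ → WithTop ℕ → Prop} (hr : OrderRel r)
    (hs : OrderRel s) (hr' : OrderRel r') (hs' : OrderRel s')
    (h : ∀ a b c, r (min a b) c ∧ s a b ↔ s' a (min b c) ∧ r' b c) (x y z : NWord D →₀ K) :
    wordOp K r (wordOp K s x y) z = wordOp K s' x (wordOp K r' y z) := by
  induction x using Finsupp.induction_linear with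
  | zero => simp
  | add x x' hx hx' => simp only [map_add, LinearMap.add_apply, hx, hx']
  | single w c =>
  rw [← mul_one c, ← smul_eq_mul, ← Finsupp.smul_single]
  simp only [map_smul, LinearMap.smul_apply]
  congr 1
  induction y using Finsupp.induction_linear with
  | zero => simp
  | add x x' hx hx' => simp only [map_add, LinearMap.add_apply, hx, hx']
  | single w' c =>
  rw [← mul_one c, ← smul_eq_mul, ← Finsupp.smul_single]
  simp only [map_smul, LinearMap.smul_apply]
  congr 1
  refine ext_coeff fun v => ?_
  classical
  -- From here on only the degrees of the first two factors matter, since they say where `v` is cut;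
  -- `z` can stay arbitrary because it is always the last factor.
  have h1 := homog_single (K := K) w
  have h2 := homog_single (K := K) w'
  generalize Finsupp.single w (1 : K) = x at *
  generalize Finsupp.single w' (1 : K) = y at *
  generalize w.1.length = k at *
  generalize w'.1.length = l at *
  rw [coeff_wordOp hr (h1.wordOp hs h2), coeff_wordOp hs h1, coeff_wordOp hs' h1,
    coeff_wordOp hr' h2]
  -- Both bracketings cut `v` at `k` and at `k + l`, and the minimum of two adjacent factors is the
  -- minimum of their minima; what is left is the hypothesis `h`.
  have e1 : (v.take (k + l)).take k = v.take k := by rw [List.take_take]; congr 1; omega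
  have e2 : (v.take (k + l)).drop k = (v.drop k).take l := by
    rw [List.drop_take]; congr 1; omega
  have e3 : (v.drop k).drop l = v.drop (k + l) := by rw [List.drop_drop]
  have e4 : v.take (k + l) = v.take k ++ (v.drop k).take l := List.take_add
  have m1 : minLetter (v.take (k + l)) =
      min (minLetter (v.take k)) (minLetter ((v.drop k).take l)) := by rw [e4, minLetter_append]
  have m2 : minLetter (v.drop k) =
      min (minLetter ((v.drop k).take l)) (minLetter (v.drop (k + l))) := by
    rw [← e3, ← minLetter_append, List.take_append_drop]
  have h' := h (minLetter (v.take k)) (minLetter ((v.drop k).take l)) (minLetter (v.drop (k + l)))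
  rw [e1, e2, e3, m1, m2]
  rw [ite_mul, zero_mul, mul_ite, mul_zero, ← ite_and, ← ite_and, mul_assoc]
  exact if_congr h' rfl rfl

/-- By trichotomy of the two minima, the three products together impose no condition. -/
theorem wordOps_star (x y : NWord D →₀ K) :
    (wordOps K D).star x y = wordOp K (fun _ _ => True) x y := by
  have : wordOp K (D := D) (fun _ _ => True) =
      wordOp K (· < ·) + wordOp K (· > ·) + wordOp K (· = ·) := by
    unfold wordOp
    rw [← bilin_add, ← bilin_add]
    congr 1
    funext w w'
    ext v
    classical
    simp only [Finsupp.add_apply, sumOver_apply, wordSet, Set.mem_ofPred_eq, and_true]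
    rcases lt_trichotomy ((v.1.take w.1.length).map Prod.fst).minimum
      ((v.1.drop w.1.length).map Prod.fst).minimum with h | h | h
    · simp only [h, h.not_gt, h.ne, and_true, and_false, if_false, add_zero]; congr
    · simp only [h, lt_irrefl, and_true, and_false, if_false, zero_add]; congr
    · simp only [h, h.not_gt, h.ne', and_true, and_false, if_false, add_zero, zero_add]
      congr
  rw [this]; rfl

theorem isNQSh_wordOps : IsNQSh (wordOps K D) where
  prec_prec x y z := by
    rw [wordOps_star]
    exact wordOp_assoc orderRel_lt orderRel_lt orderRel_true orderRel_lt (by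
      intro a b c; simp only [min_lt_iff, lt_min_iff]; grind) x y z
  succ_prec := wordOp_assoc orderRel_lt orderRel_gt orderRel_lt orderRel_gt (by
    intro a b c; simp only [gt_iff_lt, min_lt_iff]; grind)
  star_succ x y z := by
    rw [wordOps_star]
    exact wordOp_assoc orderRel_gt orderRel_true orderRel_gt orderRel_gt (by
      intro a b c; simp only [gt_iff_lt, min_lt_iff, lt_min_iff]; grind) x y z
  prec_bul := wordOp_assoc orderRel_eq orderRel_lt orderRel_gt orderRel_eq (by
    intro a b c; simp only [min_def]; grind)
  succ_bul := wordOp_assoc orderRel_eq orderRel_gt orderRel_eq orderRel_gt (by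
    intro a b c; simp only [min_def]; grind)
  bul_prec := wordOp_assoc orderRel_lt orderRel_eq orderRel_lt orderRel_eq (by
    intro a b c; simp only [min_def]; grind)
  bul_assoc := wordOp_assoc orderRel_eq orderRel_eq orderRel_eq orderRel_eq (by
    intro a b c; simp only [min_def]; grind)

end Words

/-! ### The unitization of an NQSh algebra -/

section Unit

variable {K : Type*} [Field K] {C : Type*} [AddCommGroup C] [Module K C]

/-- The right action `x ≺ u` of the unitization `K × C` on `C`, where `x ≺ 1 = x`. -/
def TriOps.precU (o : TriOps K C) : C →ₗ[K] (K × C) →ₗ[K] C :=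
  LinearMap.mk₂ K (fun x u => u.1 • x + o.prec x u.2)
    (by intros; simp; abel) (by intro c x u; simp [smul_comm u.1 c]) (by intros; simp [add_smul]; abel)
    (by intros; simp [mul_smul])

/-- The left action `u ≻ x` of the unitization `K × C` on `C`, where `1 ≻ x = x`. -/
def TriOps.succU (o : TriOps K C) : (K × C) →ₗ[K] C →ₗ[K] C :=
  LinearMap.mk₂ K (fun u x => u.1 • x + o.succ u.2 x)
    (by intros; simp [add_smul]; abel) (by intros; simp [mul_smul]) (by intros; simp; abel)
    (by intro c u x; simp [smul_comm u.1 c])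

/-- The product `⋆` of the unitization. -/
def TriOps.starU (o : TriOps K C) (u v : K × C) : K × C :=
  (u.1 * v.1, u.1 • v.2 + v.1 • u.2 + o.star u.2 v.2)

variable {o : TriOps K C}

theorem TriOps.precU_apply (x : C) (u : K × C) : o.precU x u = u.1 • x + o.prec x u.2 := rfl

theorem TriOps.succU_apply (u : K × C) (x : C) : o.succU u x = u.1 • x + o.succ u.2 x := rfl

theorem TriOps.precU_one (x : C) : o.precU x (1, 0) = x := by simp [precU_apply]

theorem TriOps.succU_one (x : C) : o.succU (1, 0) x = x := by simp [succU_apply]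

theorem TriOps.precU_zero (x y : C) : o.precU x (0, y) = o.prec x y := by simp [precU_apply]

theorem TriOps.succU_zero (x y : C) : o.succU (0, x) y = o.succ x y := by simp [succU_apply]

theorem TriOps.one_starU (u : K × C) : o.starU (1, 0) u = u := by
  ext <;> simp [starU, star]

theorem TriOps.starU_one (u : K × C) : o.starU u (1, 0) = u := by
  ext <;> simp [starU, star]

/-- The axioms survive when units are allowed to the right of `≺` and to the left of `≻`, the only
places where a leaf will occur; this and the next five lemmas are bilinear expansions. -/
theorem IsNQSh.precU_precU (h : IsNQSh o) (x : C) (u v : K × C) :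
    o.precU (o.precU x u) v = o.precU x (o.starU u v) := by
  simp only [TriOps.precU_apply, TriOps.starU, map_add, map_smul, LinearMap.add_apply,
    LinearMap.smul_apply, h.prec_prec]
  module

theorem IsNQSh.succU_precU (h : IsNQSh o) (u : K × C) (x : C) (v : K × C) :
    o.precU (o.succU u x) v = o.succU u (o.precU x v) := by
  simp only [TriOps.precU_apply, TriOps.succU_apply, map_add, map_smul, LinearMap.add_apply,
    LinearMap.smul_apply, h.succ_prec]
  module

theorem IsNQSh.starU_succU (h : IsNQSh o) (u v : K × C) (x : C) :
    o.succU (o.starU u v) x = o.succU u (o.succU v x) := by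
  simp only [TriOps.succU_apply, TriOps.starU, map_add, map_smul, LinearMap.add_apply,
    LinearMap.smul_apply, h.star_succ]
  module

theorem IsNQSh.precU_bul (h : IsNQSh o) (x : C) (u : K × C) (y : C) :
    o.bul (o.precU x u) y = o.bul x (o.succU u y) := by
  simp only [TriOps.precU_apply, TriOps.succU_apply, map_add, map_smul, LinearMap.add_apply,
    LinearMap.smul_apply, h.prec_bul]

theorem IsNQSh.succU_bul (h : IsNQSh o) (u : K × C) (x y : C) :
    o.bul (o.succU u x) y = o.succU u (o.bul x y) := by
  simp only [TriOps.succU_apply, map_add, map_smul, LinearMap.add_apply,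
    LinearMap.smul_apply, h.succ_bul]

theorem IsNQSh.bul_precU (h : IsNQSh o) (x y : C) (u : K × C) :
    o.precU (o.bul x y) u = o.bul x (o.precU y u) := by
  simp only [TriOps.precU_apply, map_add, map_smul, h.bul_prec]

end Unit

/-! ### The morphism defined by the values on corollas -/

section Tree

variable {K : Type*} [Field K] {C : Type*} [AddCommGroup C] [Module K C] {D : Type*}

/-- Induction along the expression of a tree by corollas. -/
theorem SchTree.corolla_induction {P : SchTree D → Prop} (leaf : P leaf)
    (prec : ∀ a d b, P a → P b → P (node a d [] b))
    (bul : ∀ a d c e l b, P a → P (node c e l b) → P (node a d ((c, e) :: l) b)) (t) : P t := by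
  induction hn : sizeOf t using Nat.strong_induction_on generalizing t with
  | _ n ih =>
    subst hn
    match t with
    | .leaf => exact leaf
    | node a d [] b =>
      exact prec a d b (ih _ (by simp; omega) a rfl) (ih _ (by simp) b rfl)
    | node a d ((c, e) :: l) b =>
      exact bul a d c e l b (ih _ (by simp; omega) a rfl) (ih _ (by simp; omega) _ rfl)

variable (o : TriOps K C) (g : D → C)

/-- The image of a tree in the unitization of `C`, if the corollas are sent to `g`. -/
def TriOps.evalTree : SchTree D → K × C
  | .leaf => (1, 0)
  | .node a d [] b => (0, o.precU (o.succU (evalTree a) (g d)) (evalTree b))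
  -- The first branch and its decoration are split off by `•`. The remaining tree is not a leaf, so
  -- its scalar part is zero and taking the second component loses nothing.
  | .node a d ((c, e) :: l) b =>
      (0, o.bul (o.succU (evalTree a) (g d)) (evalTree (.node c e l b)).2)
termination_by t => sizeOf t

/-- The image of a tree as a function of the image of its last branch. -/
def TriOps.evalLast (a : SchTree D) (d : D) : List (SchTree D × D) → (K × C) →ₗ[K] C
  | [] => o.precU (o.succU (o.evalTree g a) (g d))
  | (c, e) :: l => o.bul (o.succU (o.evalTree g a) (g d)) ∘ₗ evalLast c e l

theorem TriOps.evalTree_node (a : SchTree D) (d : D) (l : List (SchTree D × D)) (b : SchTree D) :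
    o.evalTree g (.node a d l b) = (0, o.evalLast g a d l (o.evalTree g b)) := by
  induction l generalizing a d with
  | nil => rw [evalTree, evalLast]
  | cons q l ih =>
    obtain ⟨c, e⟩ := q
    rw [evalTree, evalLast, ih]; rfl

/-- The linear extension of `evalTree`. -/
noncomputable def TriOps.evalLin : (SchTree D →₀ K) →ₗ[K] K × C :=
  Finsupp.linearCombination K (o.evalTree g)

theorem TriOps.evalLin_single (t : SchTree D) :
    o.evalLin g (Finsupp.single t 1) = o.evalTree g t := by simp [evalLin]

theorem TriOps.evalLin_mapDomain {f : SchTree D → SchTree D} {φ : K × C →ₗ[K] C}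
    (h : ∀ s, o.evalTree g (f s) = (0, φ (o.evalTree g s))) (X : SchTree D →₀ K) :
    o.evalLin g (X.mapDomain f) = (0, φ (o.evalLin g X)) := by
  have : o.evalLin g ∘ₗ Finsupp.lmapDomain K K f = LinearMap.inr K K C ∘ₗ φ ∘ₗ o.evalLin g := by
    ext s : 2
    simp [evalLin_single, h]
  exact LinearMap.congr_fun this X

variable {o}

/-- A right factor of the last branch moves out through every `•` by `(x • y) ≺ z = x • (y ≺ z)`,
after `x ≺ (u ⋆ v) = (x ≺ u) ≺ v` has released it. -/
theorem IsNQSh.evalLast_starU (ho : IsNQSh o) (a : SchTree D) (d : D) (l : List (SchTree D × D)) (u v : K × C) :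
    o.evalLast g a d l (o.starU u v) = o.precU (o.evalLast g a d l u) v := by
  induction l generalizing a d with
  | nil => rw [TriOps.evalLast, ho.precU_precU]
  | cons q l ih =>
    rw [TriOps.evalLast, LinearMap.comp_apply, ih, LinearMap.comp_apply, ho.bul_precU]

/-- The first branch factors out on the left by `≻`, with a leaf left in its place; this makes the
evaluation linear in that branch. -/
theorem IsNQSh.evalLast_eq (ho : IsNQSh o) (a : SchTree D) (d : D) (l : List (SchTree D × D)) (u : K × C) :
    o.evalLast g a d l u = o.succU (o.evalTree g a) (o.evalLast g .leaf d l u) := by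
  cases l with
  | nil =>
    rw [TriOps.evalLast, TriOps.evalLast, TriOps.evalTree, TriOps.succU_one, ho.succU_precU]
  | cons q l =>
    rw [TriOps.evalLast, TriOps.evalLast, LinearMap.comp_apply, LinearMap.comp_apply,
      TriOps.evalTree, TriOps.succU_one, ho.succU_bul]

/-- An inner branch can be read as the last branch of the left part or the first branch of the right
part, because `(x ≺ s) • y = x • (s ≻ y)`. -/
theorem IsNQSh.evalLast_append (ho : IsNQSh o) (a : SchTree D) (d : D) (l : List (SchTree D × D)) (s : SchTree D)
    (d' : D) (l' : List (SchTree D × D)) (u : K × C) :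
    o.evalLast g a d (l ++ (s, d') :: l') u =
      o.bul (o.evalLast g a d l (o.evalTree g s)) (o.evalLast g .leaf d' l' u) := by
  induction l generalizing a d with
  | nil =>
    rw [List.nil_append, TriOps.evalLast, ho.precU_bul, ← ho.evalLast_eq, TriOps.evalLast,
      LinearMap.comp_apply]
  | cons q l ih =>
    rw [List.cons_append, TriOps.evalLast, LinearMap.comp_apply, ih, TriOps.evalLast,
      LinearMap.comp_apply, ho.bul_assoc]

theorem TriOps.evalLin_node_last (a : SchTree D) (d : D) (l : List (SchTree D × D))
    (X : SchTree D →₀ K) :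
    o.evalLin g (X.mapDomain fun s => .node a d l s) = (0, o.evalLast g a d l (o.evalLin g X)) :=
  o.evalLin_mapDomain g (fun _ => o.evalTree_node g _ _ _ _) X

theorem IsNQSh.evalLin_node_first (ho : IsNQSh o) (d : D) (l : List (SchTree D × D)) (b : SchTree D)
    (X : SchTree D →₀ K) :
    o.evalLin g (X.mapDomain fun s => .node s d l b) =
      (0, o.succU (o.evalLin g X) (o.evalLast g .leaf d l (o.evalTree g b))) :=
  o.evalLin_mapDomain g (φ := o.succU.flip (o.evalLast g .leaf d l (o.evalTree g b)))
    (fun s => by rw [o.evalTree_node, ho.evalLast_eq]; rfl) X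

theorem IsNQSh.evalLin_node_middle (ho : IsNQSh o) (a : SchTree D) (d : D) (l : List (SchTree D × D)) (d' : D)
    (l' : List (SchTree D × D)) (b' : SchTree D) (X : SchTree D →₀ K) :
    o.evalLin g (X.mapDomain fun s => .node a d (l ++ (s, d') :: l') b') =
      (0, o.bul (o.evalLast g a d l (o.evalLin g X))
        (o.evalLast g .leaf d' l' (o.evalTree g b'))) :=
  o.evalLin_mapDomain g
    (φ := o.bul.flip (o.evalLast g .leaf d' l' (o.evalTree g b')) ∘ₗ o.evalLast g a d l)
    (fun s => by rw [o.evalTree_node, ho.evalLast_append]; rfl) X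

theorem IsNQSh.evalLin_star (ho : IsNQSh o) (t t' : SchTree D) :
    o.evalLin g (SchTree.star K t t') = o.starU (o.evalTree g t) (o.evalTree g t') := by
  induction hn : sizeOf t + sizeOf t' using Nat.strong_induction_on generalizing t t' with
  | _ n ih =>
    subst hn
    match t, t' with
    | .leaf, t' => rw [SchTree.star, TriOps.evalLin_single, TriOps.evalTree, TriOps.one_starU]
    | .node a d l b, .leaf =>
      rw [SchTree.star, TriOps.evalLin_single, TriOps.evalTree.eq_1, TriOps.starU_one]
    | .node a d l b, .node a' d' l' b' =>
      -- The three summands are graftings of `b ⋆ t'`, `t ⋆ a'` and `b ⋆ a'`, all of smaller total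
      -- size; they evaluate to the `≺`, `≻` and `•` terms of `⋆` in `C`.
      rw [SchTree.star, map_add, map_add, TriOps.evalLin_node_last, ho.evalLin_node_first,
        ho.evalLin_node_middle, ih _ (by simp) b _ rfl, ih _ (by simp; omega) _ a' rfl,
        ih _ (by simp; omega) b a' rfl, o.evalTree_node g a, o.evalTree_node g a',
        ho.evalLast_starU, ho.evalLast_starU, ho.precU_bul, ← ho.evalLast_eq,
        TriOps.precU_zero, ho.starU_succU, ← ho.evalLast_eq, TriOps.succU_zero]
      ext <;> simp [TriOps.starU, TriOps.star]

variable (o) in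
/-- The linear map on `NQSh(D)` that sends a tree to its image in `C`. -/
noncomputable def TriOps.lift : (NTree D →₀ K) →ₗ[K] C :=
  Finsupp.linearCombination K fun t => (o.evalTree g t.1).2

theorem TriOps.lift_single (t : NTree D) :
    o.lift g (Finsupp.single t 1) = (o.evalTree g t.1).2 := by simp [lift]

/-- The products of trees involve `⋆` with leaves, so they are evaluated in the unitization and
projected to `C` afterwards. -/
theorem TriOps.lift_eq (X : NTree D →₀ K) :
    o.lift g X = (o.evalLin g (X.mapDomain Subtype.val)).2 := by
  have : o.lift g = LinearMap.snd K K C ∘ₗ o.evalLin g ∘ₗ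
      Finsupp.lmapDomain K K (Subtype.val : NTree D → SchTree D) := by
    ext t
    simp [lift_single, evalLin_single]
  rw [this]; rfl

theorem TriOps.evalTree_ntree (t : NTree D) :
    o.evalTree g t.1 = (0, o.lift g (Finsupp.single t 1)) := by
  rw [lift_single]
  match t with
  | ⟨.leaf, h⟩ => exact absurd rfl h
  | ⟨.node a d l b, h⟩ => rw [evalTree_node]

theorem TriOps.lift_corolla (d : D) : o.lift g (Finsupp.single (corolla d) 1) = g d := by
  rw [lift_single, corolla, evalTree, evalTree, succU_one, precU_one]

theorem lift_bilin {p : NTree D → NTree D → (NTree D →₀ K)} {q : C →ₗ[K] C →ₗ[K] C}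
    (h : ∀ t t', o.lift g (p t t') =
      q (o.lift g (Finsupp.single t 1)) (o.lift g (Finsupp.single t' 1))) (x y : NTree D →₀ K) :
    o.lift g (bilin K p x y) = q (o.lift g x) (o.lift g y) := by
  have : (bilin K p).compr₂ (o.lift g) = q.compl₁₂ (o.lift g) (o.lift g) := by
    ext t t'
    simp [bilin, h]
  exact LinearMap.congr_fun₂ this x y

theorem IsNQSh.isTriHom_lift (ho : IsNQSh o) : IsTriHom (treeOps K D) o (o.lift g) where
  map_prec := lift_bilin g fun t t' => by
    match t with
    | ⟨.leaf, h⟩ => exact absurd rfl h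
    | ⟨.node a d l b, h⟩ =>
      rw [treePrec, TriOps.lift_eq, ← Finsupp.mapDomain_comp]
      simp only [Function.comp_def]
      rw [TriOps.evalLin_node_last, ho.evalLin_star, ho.evalLast_starU, TriOps.evalTree_ntree g t',
        TriOps.precU_zero, TriOps.lift_single g ⟨_, h⟩, o.evalTree_node]
  map_succ := lift_bilin g fun t t' => by
    match t' with
    | ⟨.leaf, h⟩ => exact absurd rfl h
    | ⟨.node a' d' l' b', h⟩ =>
      rw [treeSucc, TriOps.lift_eq, ← Finsupp.mapDomain_comp]
      simp only [Function.comp_def]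
      rw [ho.evalLin_node_first, ho.evalLin_star, ho.starU_succU, TriOps.evalTree_ntree g t,
        TriOps.succU_zero, TriOps.lift_single g ⟨_, h⟩, o.evalTree_node, ← ho.evalLast_eq]
  map_bul := lift_bilin g fun t t' => by
    match t, t' with
    | ⟨.leaf, h⟩, _ => exact absurd rfl h
    | ⟨.node a d l b, h⟩, ⟨.leaf, h'⟩ => exact absurd rfl h'
    | ⟨.node a d l b, h⟩, ⟨.node a' d' l' b', h'⟩ =>
      rw [treeBul, TriOps.lift_eq, ← Finsupp.mapDomain_comp]
      simp only [Function.comp_def]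
      rw [ho.evalLin_node_middle, ho.evalLin_star, ho.evalLast_starU, ho.precU_bul,
        TriOps.lift_single, o.evalTree_node, TriOps.lift_single, o.evalTree_node,
        ← ho.evalLast_eq]

/-- Trees are generated by the corollas. -/
theorem single_mem_of_closed {S : Submodule K (NTree D →₀ K)} (hS : (treeOps K D).Closed S)
    (h : ∀ d : D, Finsupp.single (corolla d) 1 ∈ S) (t : NTree D) : Finsupp.single t 1 ∈ S := by
  obtain ⟨t, ht⟩ := t
  induction t using SchTree.corolla_induction with
  | leaf => exact absurd rfl ht
  | prec a d b ha hb =>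
    -- This tree is `a ≻ corolla d`, or the corolla itself if `a` is a leaf; multiplying it by `b`
    -- with `≺` grafts `b` onto its last leaf, since `| ⋆ b = b`.
    have h1 : Finsupp.single ⟨.node a d [] .leaf, by simp⟩ 1 ∈ S := by
      by_cases ha' : a = .leaf
      · subst ha'; exact h d
      · convert hS.succ_mem (ha ha') (h d)
        match a with
        | .leaf => exact absurd rfl ha'
        | .node _ _ _ _ =>
          rw [treeOps, bilin_single_single, corolla, treeSucc, SchTree.star,
            Finsupp.mapDomain_single]
    by_cases hb' : b = .leaf
    · subst hb'; exact h1
    · convert hS.prec_mem h1 (hb hb')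
      rw [treeOps, bilin_single_single, treePrec, SchTree.star, Finsupp.mapDomain_single]
  | bul a d c e l b ha hb =>
    have h1 : Finsupp.single ⟨.node a d [] .leaf, by simp⟩ 1 ∈ S := by
      by_cases ha' : a = .leaf
      · subst ha'; exact h d
      · convert hS.succ_mem (ha ha') (h d)
        match a with
        | .leaf => exact absurd rfl ha'
        | .node _ _ _ _ =>
          rw [treeOps, bilin_single_single, corolla, treeSucc, SchTree.star,
            Finsupp.mapDomain_single]
    -- The product `•` joins the last leaf of the first tree with the first branch `c` of the
    -- second, and `| ⋆ c = c`.
    convert hS.bul_mem h1 (hb (by simp))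
    rw [treeOps, bilin_single_single, treeBul, SchTree.star, Finsupp.mapDomain_single]
    rfl

end Tree

/-! ### The tree of a word -/

section RhoPack

variable {D : Type*}

theorem cut_append {p : List (ℕ × D)} (hp : ∀ x ∈ p, x.1 ≠ 1) (d : D) (r : List (ℕ × D)) :
    cut (p ++ (1, d) :: r) = ((p, d) :: (cut r).1, (cut r).2) := by
  induction p with
  | nil => simp [cut]
  | cons x p ih =>
    rw [List.cons_append, cut, if_neg (hp x (by simp)), ih fun y hy => hp y (by simp [hy])]

theorem cut_of_ne {w : List (ℕ × D)} (hw : ∀ x ∈ w, x.1 ≠ 1) : cut w = ([], w) := by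
  induction w with
  | nil => simp [cut]
  | cons x w ih => rw [cut, if_neg (hw x (by simp)), ih fun y hy => hw y (by simp [hy])]

theorem cut_relabel {f : ℕ → ℕ} {w : List (ℕ × D)} (h : ∀ x ∈ w, f x.1 = 1 ↔ x.1 = 1) :
    cut (relabel f w) =
      ((cut w).1.map fun q => (relabel f q.1, q.2), relabel f (cut w).2) := by
  induction w with
  | nil => simp [cut, relabel]
  | cons x w ih =>
    have ih := ih fun y hy => h y (by simp [hy])
    have hx := h x (by simp)
    change cut ((f x.1, x.2) :: relabel f w) = _
    rw [cut, cut, ih]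
    by_cases h1 : x.1 = 1
    · rw [if_pos h1, if_pos (hx.2 h1)]; rfl
    · rw [if_neg h1, if_neg (mt hx.1 h1)]
      rcases cut w with ⟨_ | ⟨⟨p, e⟩, ps⟩, r⟩ <;> simp [relabel]

theorem cut_subset (w : List (ℕ × D)) : (∀ q ∈ (cut w).1, q.1 ⊆ w) ∧ (cut w).2 ⊆ w := by
  induction w with
  | nil => simp [cut]
  | cons x w ih =>
    rw [cut]
    split_ifs with h
    · refine ⟨?_, List.Subset.trans ih.2 (List.subset_cons_self _ _)⟩
      intro q hq
      rcases List.mem_cons.1 hq with rfl | hq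
      · simp
      · exact List.Subset.trans (ih.1 q hq) (List.subset_cons_self _ _)
    · rcases hc : cut w with ⟨_ | ⟨⟨p, e⟩, ps⟩, r⟩
      · rw [hc] at ih
        exact ⟨by simp, List.cons_subset_cons _ ih.2⟩
      · rw [hc] at ih
        refine ⟨?_, List.Subset.trans ih.2 (List.subset_cons_self _ _)⟩
        intro q hq
        rcases List.mem_cons.1 hq with rfl | hq
        · exact List.cons_subset_cons _ (ih.1 (p, e) (by simp))
        · exact List.Subset.trans (ih.1 q (by simp [hq])) (List.subset_cons_self _ _)

theorem rank_of_le {u : List ℕ} {a : ℕ} (ha : a ∈ u) (h : ∀ b ∈ u, a ≤ b) : rank u a = 1 := by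
  rw [rank, Finset.card_eq_one]
  refine ⟨a, ?_⟩
  ext b
  simp only [Finset.mem_filter, List.mem_toFinset, Finset.mem_singleton]
  exact ⟨fun hb => le_antisymm hb.2 (h b hb.1), by rintro rfl; exact ⟨ha, le_rfl⟩⟩

theorem rank_eq_one_iff {u : List ℕ} {a b : ℕ} (ha : a ∈ u) (h : ∀ b ∈ u, a ≤ b) (hb : b ∈ u) :
    rank u b = 1 ↔ b = a := by
  rw [← rank_of_le ha h]
  exact ⟨fun e => rank_injOn u hb ha e, fun e => by rw [e]⟩

/-- Words with smallest letter `1` have the tree of their packing. -/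
theorem rho_pack {w : List (ℕ × D)} (h1 : 1 ∈ w.map Prod.fst) (hw : ∀ x ∈ w, 1 ≤ x.1) :
    rho (pack w) = rho w := by
  have hc := cut_relabel (f := rank (w.map Prod.fst)) (w := w) fun x hx =>
    rank_eq_one_iff h1 (by
      intro b hb
      obtain ⟨y, hy, rfl⟩ := List.mem_map.1 hb
      exact hw y hy) (List.mem_map_of_mem hx)
  have hs := cut_subset w
  have hp : ∀ p : List (ℕ × D), p ⊆ w → pack (relabel (rank (w.map Prod.fst)) p) = pack p :=
    fun p hp => pack_relabel_rank (List.map_subset _ hp)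
  rw [← pack_eq_relabel] at hc
  rcases hcw : cut w with ⟨_ | ⟨⟨p, d⟩, ps⟩, r⟩
  · exact absurd (by rw [hcw]) (cut_ne_nil h1)
  · rw [hcw] at hc hs
    rw [rho_eq_node hc, rho_eq_node hcw, hp _ hs.2, hp _ (hs.1 (p, d) (by simp)), List.map_map]
    congr 1
    refine List.map_congr_left fun q hq => ?_
    simp only [Function.comp_apply]
    rw [hp _ (hs.1 q (by simp [hq]))]

theorem exists_mem_of_isPacked {w : List (ℕ × D)} (hw : IsPacked (w.map Prod.fst)) (h : w ≠ []) :
    1 ∈ w.map Prod.fst := by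
  obtain ⟨m, hm⟩ := hw
  obtain ⟨x, hx⟩ := List.exists_mem_of_ne_nil w h
  have := (hm x.1).1 (List.mem_map_of_mem hx)
  exact (hm 1).2 ⟨le_rfl, this.1.trans this.2⟩

theorem rho_pack_eq_leaf {w : List (ℕ × D)} : rho (pack w) = .leaf ↔ w = [] := by
  constructor
  · intro h
    by_contra hw
    have h1 := exists_mem_of_isPacked (isPacked_pack w) (mt pack_eq_nil.1 hw)
    rcases hc : cut (pack w) with ⟨_ | ⟨⟨p, d⟩, ps⟩, r⟩
    · exact absurd (by rw [hc]) (cut_ne_nil h1)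
    · rw [rho_eq_node hc] at h
      simp at h
  · rintro rfl
    exact rho_eq_leaf (r := []) (by simp [pack, cut])

/-- Every nonempty word is cut by the first occurrence of its smallest letter. -/
theorem exists_first_min {w : List (ℕ × D)} (h : w ≠ []) :
    ∃ p x d r, w = p ++ (x, d) :: r ∧ (∀ y ∈ p, x < y.1) ∧ ∀ y ∈ r, x ≤ y.1 := by
  induction w with
  | nil => exact absurd rfl h
  | cons y w ih =>
    obtain ⟨a, e⟩ := y
    by_cases hw : w = []
    · subst hw; exact ⟨[], a, e, [], by simp⟩
    · obtain ⟨p, x, d, r, rfl, hp, hr⟩ := ih hw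
      rcases le_or_gt a x with hax | hax
      · refine ⟨[], a, e, p ++ (x, d) :: r, rfl, by simp, fun y hy => ?_⟩
        rcases List.mem_append.1 hy with hy | hy
        · exact hax.trans (hp y hy).le
        · rcases List.mem_cons.1 hy with rfl | hy
          · exact hax
          · exact hax.trans (hr y hy)
      · refine ⟨(a, e) :: p, x, d, r, rfl, fun y hy => ?_, hr⟩
        rcases List.mem_cons.1 hy with rfl | hy
        · exact hax
        · exact hp y hy

/-- The packing of a word cut by the first occurrence of its smallest letter. -/
theorem exists_pack_append {p r : List (ℕ × D)} {x : ℕ} {d : D} (hp : ∀ y ∈ p, x < y.1)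
    (hr : ∀ y ∈ r, x ≤ y.1) : ∃ p' r' : List (ℕ × D),
      pack (p ++ (x, d) :: r) = p' ++ (1, d) :: r' ∧ pack p' = pack p ∧ pack r' = pack r ∧
      (∀ y ∈ p', y.1 ≠ 1) ∧ (∀ y ∈ r', 1 ≤ y.1) ∧ (1 ∈ r'.map Prod.fst ↔ x ∈ r.map Prod.fst) := by
  set w := p ++ (x, d) :: r with hw
  set u := w.map Prod.fst with hu
  have hpw : p ⊆ w := by rw [hw]; exact List.subset_append_left _ _
  have hrw : r ⊆ w := by rw [hw]; intro y hy; simp [hy]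
  have hx : x ∈ u := by rw [hu, hw]; simp
  have hmin : ∀ b ∈ u, x ≤ b := by
    intro b hb
    obtain ⟨y, hy, rfl⟩ := List.mem_map.1 hb
    rcases List.mem_append.1 hy with hy | hy
    · exact (hp y hy).le
    · rcases List.mem_cons.1 hy with rfl | hy
      · exact le_rfl
      · exact hr y hy
  have hone : ∀ y ∈ w, rank u y.1 = 1 ↔ y.1 = x := fun y hy =>
    rank_eq_one_iff hx hmin (List.mem_map_of_mem hy)
  -- The pieces are relabelled by ranks in the whole word, under which `x`, and no other letter,
  -- becomes `1`.
  refine ⟨relabel (rank u) p, relabel (rank u) r, ?_, pack_relabel_rank (List.map_subset _ hpw),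
    pack_relabel_rank (List.map_subset _ hrw), ?_, ?_, ?_⟩
  · rw [pack_eq_relabel, ← hu, hw, relabel, List.map_append, List.map_cons, rank_of_le hx hmin]
    rfl
  · intro y hy
    obtain ⟨z, hz, rfl⟩ := List.mem_map.1 hy
    exact mt (hone z (hpw hz)).1 (hp z hz).ne'
  · intro y hy
    obtain ⟨z, hz, rfl⟩ := List.mem_map.1 hy
    exact Finset.card_pos.2 ⟨z.1, (Finset.mem_filter (p := (· ≤ z.1))).2
      ⟨List.mem_toFinset.2 (List.mem_map_of_mem (hrw hz)), le_rfl⟩⟩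
  · rw [map_fst_relabel, List.mem_map]
    constructor
    · rintro ⟨a, ha, h⟩
      obtain ⟨z, hz, rfl⟩ := List.mem_map.1 ha
      rw [← (hone z (hrw hz)).1 h]
      exact ha
    · exact fun h => ⟨x, h, rank_of_le hx hmin⟩

theorem rho_pack_append_of_lt {p r : List (ℕ × D)} {x : ℕ} {d : D} (hp : ∀ y ∈ p, x < y.1)
    (hr : ∀ y ∈ r, x < y.1) :
    rho (pack (p ++ (x, d) :: r)) = .node (rho (pack p)) d [] (rho (pack r)) := by
  obtain ⟨p', r', e, ep, er, hp', -, h1⟩ := exists_pack_append (d := d) hp fun y hy => (hr y hy).le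
  have hr' : ∀ y ∈ r', y.1 ≠ 1 := fun y hy h => by
    obtain ⟨z, hz, hzx⟩ := List.mem_map.1 (h1.1 (h ▸ List.mem_map_of_mem hy))
    exact (hr z hz).ne' hzx
  rw [e, rho_eq_node (by rw [cut_append hp', cut_of_ne hr']), ep, er]
  rfl

theorem rho_pack_append_of_mem {p r : List (ℕ × D)} {x : ℕ} {d : D} (hp : ∀ y ∈ p, x < y.1)
    (hr : ∀ y ∈ r, x ≤ y.1) (hx : x ∈ r.map Prod.fst) {c e l b}
    (h : rho (pack r) = .node c e l b) :
    rho (pack (p ++ (x, d) :: r)) = .node (rho (pack p)) d ((c, e) :: l) b := by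
  obtain ⟨p', r', e', ep, er, hp', hr', h1⟩ := exists_pack_append (d := d) hp hr
  -- The factor `r'` need not be packed, as letters of `p'` may fill gaps in it; having minimum `1`
  -- is enough for its tree to be that of its packing.
  rw [← er, rho_pack (h1.2 hx) hr'] at h
  rcases hc : cut r' with ⟨_ | ⟨⟨q, d'⟩, ps⟩, s⟩
  · exact absurd (by rw [hc]) (cut_ne_nil (h1.2 hx))
  · rw [rho_eq_node hc] at h
    simp only [SchTree.node.injEq] at h
    obtain ⟨rfl, rfl, rfl, rfl⟩ := h
    rw [e', rho_eq_node (by rw [cut_append hp', hc]), ep]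
    rfl

theorem exists_rho_pack_eq_node {w : List (ℕ × D)} (h : w ≠ []) :
    ∃ c e l b, rho (pack w) = .node c e l b := by
  cases h' : rho (pack w) with
  | leaf => exact absurd (rho_pack_eq_leaf.1 h') h
  | node c e l b => exact ⟨c, e, l, b, rfl⟩

/-- The words whose tree has a root with two branches. -/
theorem rho_pack_eq_node_nil {w : List (ℕ × D)} {a : SchTree D} {d : D} {b : SchTree D} :
    rho (pack w) = .node a d [] b ↔ ∃ p x r, w = p ++ (x, d) :: r ∧ (∀ y ∈ p, x < y.1) ∧
      (∀ y ∈ r, x < y.1) ∧ rho (pack p) = a ∧ rho (pack r) = b := by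
  constructor
  · intro h
    have hw : w ≠ [] := fun hw => by simp [rho_pack_eq_leaf.2 hw] at h
    obtain ⟨p, x, d', r, rfl, hp, hr⟩ := exists_first_min hw
    by_cases hx : x ∈ r.map Prod.fst
    · obtain ⟨c, e, l, b', h'⟩ := exists_rho_pack_eq_node (w := r) (by rintro rfl; simp at hx)
      rw [rho_pack_append_of_mem hp hr hx h'] at h
      simp at h
    · have hr' : ∀ y ∈ r, x < y.1 := fun y hy => lt_of_le_of_ne (hr y hy)
        (by rintro rfl; exact hx (List.mem_map_of_mem hy))
      rw [rho_pack_append_of_lt hp hr'] at h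
      simp only [SchTree.node.injEq, true_and] at h
      obtain ⟨h1, rfl, h2⟩ := h
      exact ⟨p, x, r, rfl, hp, hr', h1, h2⟩
  · rintro ⟨p, x, r, rfl, hp, hr, rfl, rfl⟩
    exact rho_pack_append_of_lt hp hr

/-- The words whose tree has a root with more than two branches. -/
theorem rho_pack_eq_node_cons {w : List (ℕ × D)} {a : SchTree D} {d : D} {c : SchTree D} {e : D}
    {l : List (SchTree D × D)} {b : SchTree D} :
    rho (pack w) = .node a d ((c, e) :: l) b ↔ ∃ p x r, w = p ++ (x, d) :: r ∧
      (∀ y ∈ p, x < y.1) ∧ (∀ y ∈ r, x ≤ y.1) ∧ x ∈ r.map Prod.fst ∧ rho (pack p) = a ∧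
      rho (pack r) = .node c e l b := by
  constructor
  · intro h
    have hw : w ≠ [] := fun hw => by simp [rho_pack_eq_leaf.2 hw] at h
    obtain ⟨p, x, d', r, rfl, hp, hr⟩ := exists_first_min hw
    by_cases hx : x ∈ r.map Prod.fst
    · obtain ⟨c', e', l', b', h'⟩ := exists_rho_pack_eq_node (w := r) (by rintro rfl; simp at hx)
      rw [rho_pack_append_of_mem hp hr hx h'] at h
      simp only [SchTree.node.injEq, List.cons.injEq, Prod.mk.injEq] at h
      obtain ⟨h1, rfl, ⟨⟨rfl, rfl⟩, rfl⟩, rfl⟩ := h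
      exact ⟨p, x, r, rfl, hp, hr, hx, h1, h'⟩
    · have hr' : ∀ y ∈ r, x < y.1 := fun y hy => lt_of_le_of_ne (hr y hy)
        (by rintro rfl; exact hx (List.mem_map_of_mem hy))
      rw [rho_pack_append_of_lt hp hr'] at h
      simp at h
  · rintro ⟨p, x, r, rfl, hp, hr, hx, rfl, h⟩
    exact rho_pack_append_of_mem hp hr hx h

/-- Every tree is the tree of some word. -/
theorem exists_rho_pack (t : SchTree D) : ∃ w : List (ℕ × D), rho (pack w) = t := by
  have shift : ∀ (n : ℕ) (w : List (ℕ × D)), pack (relabel (· + n) w) = pack w := fun n w =>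
    pack_relabel fun _ _ _ _ h => Nat.add_lt_add_right h n
  have above : ∀ (n : ℕ) (w : List (ℕ × D)), ∀ y ∈ relabel (· + (n + 1)) w, n < y.1 := by
    intro n w y hy
    obtain ⟨z, -, rfl⟩ := List.mem_map.1 hy
    simp only
    omega
  induction t using SchTree.corolla_induction with
  | leaf => exact ⟨[], rho_pack_eq_leaf.2 rfl⟩
  | prec a d b ha hb =>
    obtain ⟨p, rfl⟩ := ha
    obtain ⟨r, rfl⟩ := hb
    -- Only the packing matters, so the letter `0` may serve as a strict minimum once both words are
    -- raised by one.
    refine ⟨_, rho_pack_eq_node_nil.2 ⟨relabel (· + 1) p, 0, relabel (· + 1) r, rfl, above 0 p, above 0 r,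
      by rw [shift], by rw [shift]⟩⟩
  | bul a d c e l b ha hb =>
    obtain ⟨p, rfl⟩ := ha
    obtain ⟨r, hr⟩ := hb
    have hr0 : r ≠ [] := fun h => by simp [rho_pack_eq_leaf.2 h] at hr
    have hpos : ∀ y ∈ pack r, 1 ≤ y.1 := fun y hy => by
      obtain ⟨m, hm⟩ := isPacked_pack r
      exact ((hm y.1).1 (List.mem_map_of_mem hy)).1
    -- The separating letter must equal the minimum of the right factor, which packing makes `1`;
    -- letters of `p` may be `0`, hence the shift by two.
    refine ⟨_, rho_pack_eq_node_cons.2 ⟨relabel (· + 2) p, 1, pack r, rfl, above 1 p, hpos,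
      exists_mem_of_isPacked (isPacked_pack r) (mt pack_eq_nil.1 hr0), by rw [shift],
      by rw [pack_pack, hr]⟩⟩

end RhoPack

/-! ### The map `Ω` as a morphism -/

section OmegaHom

variable {K : Type*} [Field K] {D : Type*}

open scoped Classical in
/-- The coefficients of an element of the unitization of the word algebra. -/
noncomputable def coeffU (w : List (ℕ × D)) (u : K × (NWord D →₀ K)) : K :=
  if w = [] then u.1 else coeff K w u.2

theorem coeffU_zero (w : List (ℕ × D)) (X : NWord D →₀ K) : coeffU w (0, X) = coeff K w X := by
  rw [coeffU]
  split_ifs with h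
  · rw [h, coeff_nil]
  · rfl

theorem coeffU_nil (u : K × (NWord D →₀ K)) : coeffU [] u = u.1 := by simp [coeffU]

theorem coeffU_of_ne {w : List (ℕ × D)} (h : w ≠ []) (u : K × (NWord D →₀ K)) :
    coeffU w u = coeff K w u.2 := by simp [coeffU, h]

open scoped Classical in
theorem coeff_precU {k : ℕ} {X : NWord D →₀ K} (hX : Homog k X) (u : K × (NWord D →₀ K))
    (w : List (ℕ × D)) :
    coeff K w ((wordOps K D).precU X u) =
      if minLetter (w.take k) < minLetter (w.drop k) then
        coeff K (w.take k) X * coeffU (w.drop k) u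
      else 0 := by
  have e : coeff K w ((wordOps K D).prec X u.2) =
      if minLetter (w.take k) < minLetter (w.drop k) then
        coeff K (w.take k) X * coeff K (w.drop k) u.2 else 0 := coeff_wordOp orderRel_lt hX _ w
  rw [TriOps.precU_apply, map_add, map_smul, e]
  -- The scalar part of `u` contributes exactly when nothing follows the first `k` letters; the
  -- missing piece then has minimum `⊤`, so the condition holds for nonempty `w`.
  by_cases hw : w.drop k = []
  · have hk := List.drop_eq_nil_iff.1 hw
    rw [hw, coeff_nil, coeffU_nil, List.take_of_length_le hk, minLetter_nil]
    by_cases h : w = []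
    · subst h; simp [coeff_nil]
    · simp [minLetter_lt_top.2 h, mul_comm]
  · rw [hX w (fun h => hw (List.drop_eq_nil_iff.2 h.le)), coeffU_of_ne hw]
    simp

open scoped Classical in
theorem coeff_succU {k : ℕ} {u : K × (NWord D →₀ K)}
    (hu : ∀ w : List (ℕ × D), w.length ≠ k → coeffU w u = 0) (X : NWord D →₀ K)
    (w : List (ℕ × D)) :
    coeff K w ((wordOps K D).succU u X) =
      if minLetter (w.drop k) < minLetter (w.take k) then
        coeffU (w.take k) u * coeff K (w.drop k) X
      else 0 := by
  rw [TriOps.succU_apply, map_add, map_smul]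
  -- Homogeneity in the unitization leaves two cases: `u` is a scalar in degree zero, and has no
  -- scalar part in positive degree.
  by_cases hk : k = 0
  · subst hk
    have h2 : u.2 = 0 := ext_coeff fun v => by
      by_cases hv : v = []
      · subst hv; rw [coeff_nil, coeff_nil]
      · rw [← coeffU_of_ne hv, hu v (by simpa using hv), map_zero]
    rw [h2, map_zero, List.take_zero, List.drop_zero, coeffU_nil, minLetter_nil]
    by_cases h : w = []
    · subst h; simp [coeff_nil]
    · simp [minLetter_lt_top.2 h]
  · have h1 : u.1 = 0 := by rw [← coeffU_nil u, hu [] (Ne.symm hk)]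
    have h2 : Homog k u.2 := fun v hv => by
      by_cases hv' : v = []
      · subst hv'; rw [coeff_nil]
      · rw [← coeffU_of_ne hv', hu v hv]
    have e : coeff K w ((wordOps K D).succ u.2 X) =
      if minLetter (w.drop k) < minLetter (w.take k) then
        coeff K (w.take k) u.2 * coeff K (w.drop k) X else 0 := coeff_wordOp orderRel_gt h2 _ w
    rw [h1, zero_smul, zero_add, e]
    by_cases h : w = []
    · subst h; simp
    · rw [coeffU_of_ne (by simp [hk, h])]

theorem minLetter_append_singleton {p : List (ℕ × D)} {x : ℕ} {d : D} (hp : ∀ y ∈ p, x < y.1) :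
    minLetter (p ++ [(x, d)]) = x := by
  refine List.minimum_eq_coe_iff.2 ⟨by simp, fun a ha => ?_⟩
  obtain ⟨y, hy, rfl⟩ := List.mem_map.1 ha
  rcases List.mem_append.1 hy with hy | hy
  · exact (hp y hy).le
  · obtain rfl := List.mem_singleton.1 hy
    exact le_rfl

theorem coe_lt_minLetter {x : ℕ} {r : List (ℕ × D)} :
    (x : WithTop ℕ) < minLetter r ↔ ∀ y ∈ r, x < y.1 := by
  cases r with
  | nil => simp [minLetter_nil]
  | cons z r =>
    have : (x : WithTop ℕ) = minLetter [(x, z.2)] := rfl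
    rw [this, minLetter_lt_iff]
    simp

theorem coe_eq_minLetter {x : ℕ} {r : List (ℕ × D)} :
    (x : WithTop ℕ) = minLetter r ↔ (∀ y ∈ r, x ≤ y.1) ∧ x ∈ r.map Prod.fst := by
  rw [eq_comm, and_comm]
  refine List.minimum_eq_coe_iff.trans (and_congr_right fun _ => ?_)
  simp only [List.mem_map, forall_exists_index, and_imp, forall_apply_eq_imp_iff₂, Nat.cast_id]

/-- The tree keeps all decorations, hence the length. This provides the homogeneity used to cut
words at a position determined by the tree. -/
theorem length_of_rho_pack {w : List (ℕ × D)} {t : SchTree D} (h : rho (pack w) = t) :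
    w.length = t.dec.length := by
  rw [← h, dec_rho _ (isPacked_pack w), List.length_map, length_pack]

/-- The words obtained from a word of tree `a` by adding a smaller last letter decorated by `d`. -/
def AddLast (a : SchTree D) (d : D) (v p : List (ℕ × D)) (x : ℕ) : Prop :=
  v = p ++ [(x, d)] ∧ (∀ y ∈ p, x < y.1) ∧ rho (pack p) = a

theorem AddLast.length_eq {a : SchTree D} {d : D} {v p : List (ℕ × D)} {x : ℕ}
    (h : AddLast a d v p x) : v.length = a.dec.length + 1 := by
  rw [h.1, ← length_of_rho_pack h.2.2]; simp

open scoped Classical in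
theorem coeff_succU_letter {a : SchTree D} {u : K × (NWord D →₀ K)}
    (hu : ∀ w, coeffU w u = if rho (pack w) = a then 1 else 0) (d : D) (v : List (ℕ × D)) :
    coeff K v ((wordOps K D).succU u (Finsupp.single (letter d) 1)) =
      if ∃ p x, AddLast a d v p x then 1 else 0 := by
  have hk : ∀ w : List (ℕ × D), w.length ≠ a.dec.length → coeffU w u = 0 := fun w hw => by
    rw [hu, if_neg (mt length_of_rho_pack hw)]
  rw [coeff_succU hk, hu, coeff_single, ite_zero_mul_ite_zero, mul_one, ← ite_and]
  refine if_congr ?_ rfl rfl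
  constructor
  · rintro ⟨h1, h2, h3⟩
    obtain ⟨⟨x, d'⟩, hx, h4⟩ := List.map_eq_singleton_iff.1 h3
    obtain rfl : d' = d := (Prod.mk.inj h4).2
    refine ⟨v.take a.dec.length, x, by rw [← hx, List.take_append_drop], ?_, h2⟩
    rw [hx] at h1
    exact coe_lt_minLetter.1 h1
  · rintro ⟨p, x, rfl, hp, h⟩
    have hl := length_of_rho_pack h
    rw [List.take_left' hl, List.drop_left' hl]
    refine ⟨coe_lt_minLetter.2 hp, h, ?_⟩
    simp [pack, letter, rank_of_le (u := [x]) (a := x)]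

open scoped Classical in
/-- The words of a given tree, expressed by the products. -/
theorem coeffU_evalTree (t : SchTree D) (w : List (ℕ × D)) :
    coeffU w ((wordOps K D).evalTree (fun d => Finsupp.single (letter d) 1) t) =
      if rho (pack w) = t then 1 else 0 := by
  induction t using SchTree.corolla_induction generalizing w with
  | leaf =>
    rw [TriOps.evalTree]
    simp [coeffU, rho_pack_eq_leaf]
  | prec a d b ha hb =>
    have hY := coeff_succU_letter ha d
    -- The factor `a ≻ letter d` consists of words of one fixed length, so cutting after it puts the
    -- first minimum at the end of the left piece; `≺` says that this minimum does not recur.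
    have hh : Homog (a.dec.length + 1) _ := fun w hw => (hY w).trans
      (if_neg fun ⟨_, _, h⟩ => hw h.length_eq)
    rw [TriOps.evalTree, coeffU_zero, coeff_precU hh, hY, hb, ite_zero_mul_ite_zero, mul_one,
      ← ite_and, rho_pack_eq_node_nil]
    refine if_congr ?_ rfl rfl
    constructor
    · rintro ⟨h1, ⟨p, x, h2, h3, h4⟩, h5⟩
      rw [h2, minLetter_append_singleton h3] at h1
      refine ⟨p, x, w.drop (a.dec.length + 1), ?_, h3, coe_lt_minLetter.1 h1, h4, h5⟩
      conv_lhs => rw [← List.take_append_drop (a.dec.length + 1) w, h2]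
      simp
    · rintro ⟨p, x, r, rfl, h2, h3, h4, h5⟩
      have hl : (p ++ [(x, d)]).length = a.dec.length + 1 := by
        rw [← length_of_rho_pack h4]; simp
      rw [List.append_cons, List.take_left' hl, List.drop_left' hl, minLetter_append_singleton h2]
      exact ⟨coe_lt_minLetter.2 h3, ⟨p, x, rfl, h2, h4⟩, h5⟩
  | bul a d c e l b ha hb =>
    have hY := coeff_succU_letter ha d
    have hh : Homog (a.dec.length + 1) _ := fun w hw => (hY w).trans
      (if_neg fun ⟨_, _, h⟩ => hw h.length_eq)
    have hb' : ∀ w, coeff K w ((wordOps K D).evalTree (fun d => Finsupp.single (letter d) 1)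
        (.node c e l b)).2 = if rho (pack w) = .node c e l b then 1 else 0 := fun w => by
      rw [← hb, TriOps.evalTree_node, coeffU_zero]
    rw [TriOps.evalTree, coeffU_zero]
    -- Equality of the two minima means that the smallest letter occurs again in the right piece,
    -- which is the case of more than two branches.
    refine (coeff_wordOp orderRel_eq hh _ w).trans ?_
    rw [hY, hb', ite_zero_mul_ite_zero, mul_one, ← ite_and, rho_pack_eq_node_cons]
    refine if_congr ?_ rfl rfl
    constructor
    · rintro ⟨h1, ⟨p, x, h2, h3, h4⟩, h5⟩
      rw [h2, minLetter_append_singleton h3] at h1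
      obtain ⟨h6, h7⟩ := coe_eq_minLetter.1 h1
      refine ⟨p, x, w.drop (a.dec.length + 1), ?_, h3, h6, h7, h4, h5⟩
      conv_lhs => rw [← List.take_append_drop (a.dec.length + 1) w, h2]
      simp
    · rintro ⟨p, x, r, rfl, h2, h3, h6, h4, h5⟩
      have hl : (p ++ [(x, d)]).length = a.dec.length + 1 := by
        rw [← length_of_rho_pack h4]; simp
      rw [List.append_cons, List.take_left' hl, List.drop_left' hl, minLetter_append_singleton h2]
      exact ⟨coe_eq_minLetter.2 ⟨h3, h6⟩, ⟨p, x, rfl, h2, h4⟩, h5⟩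

open scoped Classical in
theorem coeff_Omega_single (t : NTree D) (w : List (ℕ × D)) :
    coeff K w (Omega K D (Finsupp.single t 1)) = if rho (pack w) = t.1 then 1 else 0 := by
  by_cases h : w = []
  · rw [h, coeff_nil, rho_pack_eq_leaf.2 rfl, if_neg t.2.symm]
  · rw [coeff_of_ne h, Omega, Finsupp.linearCombination_single, one_smul, sumOver_apply]
    rfl

/-- The coefficients of `Ω(x)` are the coefficients of `x` at the trees of the words. -/
theorem coeff_Omega {t : NTree D} {w : List (ℕ × D)} (h : rho (pack w) = t.1)
    (x : NTree D →₀ K) : coeff K w (Omega K D x) = x t := by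
  have : coeff K w ∘ₗ Omega K D = Finsupp.lapply t := by
    classical
    ext s
    simp only [LinearMap.comp_apply, Finsupp.lsingle_apply, coeff_Omega_single, h,
      Finsupp.lapply_apply, Finsupp.single_apply]
    exact if_congr (by rw [Subtype.ext_iff, eq_comm]) rfl rfl
  exact LinearMap.congr_fun this x

theorem Omega_injective : Function.Injective (Omega K D) := fun x y h => by
  ext t
  obtain ⟨w, hw⟩ := exists_rho_pack t.1
  rw [← coeff_Omega hw, ← coeff_Omega hw, h]

/-- This identifies the sum over fibres with the evaluation at one-letter words, so that `Ω`
inherits multiplicativity from the general result. -/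
theorem Omega_eq_lift :
    Omega K D = (wordOps K D).lift fun d => Finsupp.single (letter d) 1 := by
  refine Finsupp.lhom_ext' fun t => LinearMap.ext_ring (ext_coeff fun w => ?_)
  classical
  change coeff K w (Omega K D (Finsupp.single t 1)) =
    coeff K w ((wordOps K D).lift _ (Finsupp.single t 1))
  rw [coeff_Omega_single, ← coeffU_zero w (TriOps.lift _ _ _), ← TriOps.evalTree_ntree,
    coeffU_evalTree]

theorem isTriHom_Omega : IsTriHom (treeOps K D) (wordOps K D) (Omega K D) := by
  rw [Omega_eq_lift]
  exact isNQSh_wordOps.isTriHom_lift _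

theorem Omega_corolla (d : D) :
    Omega K D (Finsupp.single (corolla d) 1) = Finsupp.single (letter d) 1 := by
  rw [Omega_eq_lift, TriOps.lift_corolla]

end OmegaHom

/-! ### Freeness -/

section Free

variable {K : Type*} [Field K] {A : Type*} [AddCommGroup A] [Module K A]
  {B : Type*} [AddCommGroup B] [Module K B]

theorem IsTriHom.map_star {o : TriOps K A} {o' : TriOps K B} {f : A →ₗ[K] B}
    (hf : IsTriHom o o' f) (x y : A) : f (o.star x y) = o'.star (f x) (f y) := by
  simp only [TriOps.star, map_add, hf.map_prec, hf.map_succ, hf.map_bul]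

theorem IsTriHom.comp {C : Type*} [AddCommGroup C] [Module K C] {o : TriOps K A}
    {o' : TriOps K B} {o'' : TriOps K C} {g : B →ₗ[K] C} {f : A →ₗ[K] B}
    (hg : IsTriHom o' o'' g) (hf : IsTriHom o o' f) : IsTriHom o o'' (g ∘ₗ f) where
  map_prec x y := by simp [hf.map_prec, hg.map_prec]
  map_succ x y := by simp [hf.map_succ, hg.map_succ]
  map_bul x y := by simp [hf.map_bul, hg.map_bul]

theorem IsTriHom.symm {o : TriOps K A} {o' : TriOps K B} {e : A ≃ₗ[K] B}
    (he : IsTriHom o o' e.toLinearMap) : IsTriHom o' o e.symm.toLinearMap where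
  map_prec x y := e.injective (by simpa using (he.map_prec (e.symm x) (e.symm y)).symm)
  map_succ x y := e.injective (by simpa using (he.map_succ (e.symm x) (e.symm y)).symm)
  map_bul x y := e.injective (by simpa using (he.map_bul (e.symm x) (e.symm y)).symm)

/-- The axioms are identities, and an injective morphism reflects them. This is how the tree algebra
obtains them from words. -/
theorem IsTriHom.isNQSh_of_injective {o : TriOps K A} {o' : TriOps K B} {f : A →ₗ[K] B}
    (hf : IsTriHom o o' f) (hi : Function.Injective f) (h : IsNQSh o') : IsNQSh o := by
  constructor <;> intro x y z <;> apply hi <;>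
    simp only [hf.map_prec, hf.map_succ, hf.map_bul, hf.map_star]
  · exact h.prec_prec _ _ _
  · exact h.succ_prec _ _ _
  · exact h.star_succ _ _ _
  · exact h.prec_bul _ _ _
  · exact h.succ_bul _ _ _
  · exact h.bul_prec _ _ _
  · exact h.bul_assoc _ _ _

theorem IsTriHom.closed_eqLocus {o : TriOps K A} {o' : TriOps K B} {f g : A →ₗ[K] B}
    (hf : IsTriHom o o' f) (hg : IsTriHom o o' g) : o.Closed (LinearMap.eqLocus f g) where
  prec_mem {x y} hx hy := by
    rw [LinearMap.mem_eqLocus] at *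
    rw [hf.map_prec, hg.map_prec, hx, hy]
  succ_mem {x y} hx hy := by
    rw [LinearMap.mem_eqLocus] at *
    rw [hf.map_succ, hg.map_succ, hx, hy]
  bul_mem {x y} hx hy := by
    rw [LinearMap.mem_eqLocus] at *
    rw [hf.map_bul, hg.map_bul, hx, hy]

theorem IsTriHom.closed_range {o : TriOps K A} {o' : TriOps K B} {f : A →ₗ[K] B}
    (hf : IsTriHom o o' f) : o'.Closed (LinearMap.range f) where
  prec_mem := by
    rintro _ _ ⟨x, rfl⟩ ⟨y, rfl⟩
    exact ⟨_, hf.map_prec x y⟩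
  succ_mem := by
    rintro _ _ ⟨x, rfl⟩ ⟨y, rfl⟩
    exact ⟨_, hf.map_succ x y⟩
  bul_mem := by
    rintro _ _ ⟨x, rfl⟩ ⟨y, rfl⟩
    exact ⟨_, hf.map_bul x y⟩

theorem IsTriHom.closed_comap {o : TriOps K A} {o' : TriOps K B} {f : A →ₗ[K] B}
    (hf : IsTriHom o o' f) {S : Submodule K B} (hS : o'.Closed S) : o.Closed (S.comap f) where
  prec_mem {x y} hx hy := by
    rw [Submodule.mem_comap, hf.map_prec]; exact hS.prec_mem hx hy
  succ_mem {x y} hx hy := by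
    rw [Submodule.mem_comap, hf.map_succ]; exact hS.succ_mem hx hy
  bul_mem {x y} hx hy := by
    rw [Submodule.mem_comap, hf.map_bul]; exact hS.bul_mem hx hy

theorem IsFreeNQSh.of_equiv.{w, a, b, b', c} {K : Type a} [Field K] {A : Type b} [AddCommGroup A]
    [Module K A] {B : Type b'} [AddCommGroup B] [Module K B] {D : Type c} {o : TriOps K A}
    {o' : TriOps K B} {ι : D → A} {ι' : D → B} (h : IsFreeNQSh.{w} o ι) (e : A ≃ₗ[K] B)
    (he : IsTriHom o o' e.toLinearMap) (hι : ∀ d, e (ι d) = ι' d) : IsFreeNQSh.{w} o' ι' := by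
  refine ⟨he.symm.isNQSh_of_injective e.symm.injective h.1, fun C _ _ oC hC g => ?_⟩
  obtain ⟨f, ⟨hf, hfg⟩, huniq⟩ := h.2 C oC hC g
  refine ⟨f ∘ₗ e.symm.toLinearMap, ⟨hf.comp he.symm, fun d => ?_⟩, ?_⟩
  · simp [← hι, hfg]
  · rintro f' ⟨hf', hfg'⟩
    rw [← huniq (f' ∘ₗ e.toLinearMap) ⟨hf'.comp he, fun d => by simp [hι, hfg']⟩]
    ext x
    simp

theorem closed_eq_top {D : Type*} {S : Submodule K (NTree D →₀ K)} (hS : (treeOps K D).Closed S)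
    (h : ∀ d : D, Finsupp.single (corolla d) 1 ∈ S) : S = ⊤ := by
  refine eq_top_iff.2 fun x _ => ?_
  rw [← Finsupp.sum_single x]
  refine Submodule.sum_mem _ fun t _ => ?_
  rw [← mul_one (x t), ← smul_eq_mul, ← Finsupp.smul_single]
  exact S.smul_mem _ (single_mem_of_closed hS h t)

theorem isFreeNQSh_treeOps.{w, a, c} (K : Type a) [Field K] (D : Type c) :
    IsFreeNQSh.{w} (treeOps K D) fun d => Finsupp.single (corolla d) (1 : K) := by
  refine ⟨isTriHom_Omega.isNQSh_of_injective Omega_injective isNQSh_wordOps,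
    fun C _ _ oC hC g => ⟨oC.lift g, ⟨hC.isTriHom_lift g, TriOps.lift_corolla g⟩, ?_⟩⟩
  rintro f ⟨hf, hfg⟩
  -- Uniqueness: the locus where two morphisms agree is closed under the products and contains the
  -- corollas, so it is everything.
  have := closed_eq_top (hf.closed_eqLocus (hC.isTriHom_lift g)) fun d => by
    rw [LinearMap.mem_eqLocus, hfg, TriOps.lift_corolla]
  exact LinearMap.eqLocus_eq_top.1 this

variable (K) (D : Type*)

/-- The preimage of `QDesc` is closed and contains the corollas. The opposite inclusion, next, is
minimality of `QDesc` applied to the closed subspace `range Ω`. -/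
theorem Omega_mem_QDesc (x : NTree D →₀ K) : Omega K D x ∈ QDesc K D := by
  have := closed_eq_top (S := (QDesc K D).comap (Omega K D))
    (isTriHom_Omega.closed_comap ((wordOps K D).closed_generated _)) fun d => by
      rw [Submodule.mem_comap, Omega_corolla]
      exact (wordOps K D).subset_generated _ ⟨d, rfl⟩
  exact (this ▸ Submodule.mem_top : x ∈ (QDesc K D).comap (Omega K D))

theorem QDesc_le_range : QDesc K D ≤ LinearMap.range (Omega K D) := by
  refine sInf_le ⟨?_, isTriHom_Omega.closed_range⟩
  rintro _ ⟨d, rfl⟩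
  exact ⟨_, Omega_corolla d⟩

/-- The isomorphism from `NQSh(D)` onto `QDesc` induced by `Ω`. -/
noncomputable def treeEquivQDesc : (NTree D →₀ K) ≃ₗ[K] QDesc K D :=
  LinearEquiv.ofBijective ((Omega K D).codRestrict (QDesc K D) (Omega_mem_QDesc K D))
    ⟨fun _ _ h => Omega_injective (congrArg Subtype.val h), fun y => by
      obtain ⟨x, hx⟩ := QDesc_le_range K D y.2
      exact ⟨x, Subtype.ext hx⟩⟩

theorem coe_treeEquivQDesc (x : NTree D →₀ K) :
    (treeEquivQDesc K D x : NWord D →₀ K) = Omega K D x := rfl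

theorem isTriHom_treeEquivQDesc :
    IsTriHom (treeOps K D) (qdescOps K D) (treeEquivQDesc K D).toLinearMap where
  map_prec x y := Subtype.ext (isTriHom_Omega.map_prec x y)
  map_succ x y := Subtype.ext (isTriHom_Omega.map_succ x y)
  map_bul x y := Subtype.ext (isTriHom_Omega.map_bul x y)

end Free

end QuasiShuffle

theorem mainTheorem8 (K : Type u) [Field K] :
    -- the nonempty packed words decorated by positive integers span an NQSh algebra
    QuasiShuffle.IsNQSh (QuasiShuffle.wordOps K ℕ+) ∧
    -- the decorated Schröder trees form a basis of the free NQSh algebra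
    QuasiShuffle.IsFreeNQSh.{v, u, u, 0} (QuasiShuffle.treeOps K ℕ+)
      (fun d => Finsupp.single (QuasiShuffle.corolla d) (1 : K)) ∧
    -- `Ω` is an injective morphism
    QuasiShuffle.IsTriHom (QuasiShuffle.treeOps K ℕ+) (QuasiShuffle.wordOps K ℕ+)
      (QuasiShuffle.Omega K ℕ+) ∧
    Function.Injective (QuasiShuffle.Omega K ℕ+) ∧
    -- `QDesc` is free on the words of length one
    QuasiShuffle.IsFreeNQSh.{v, u, u, 0} (QuasiShuffle.qdescOps K ℕ+) (QuasiShuffle.qdescGen K) ∧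
    -- `Ω` induces an isomorphism onto `QDesc`
    ∃ e : (QuasiShuffle.NTree ℕ+ →₀ K) ≃ₗ[K] QuasiShuffle.QDesc K ℕ+,
      QuasiShuffle.IsTriHom (QuasiShuffle.treeOps K ℕ+) (QuasiShuffle.qdescOps K ℕ+)
        e.toLinearMap ∧
      ∀ x, (e x : QuasiShuffle.NWord ℕ+ →₀ K) = QuasiShuffle.Omega K ℕ+ x := by
  have hfree := QuasiShuffle.isFreeNQSh_treeOps.{v} K ℕ+
  have he := QuasiShuffle.isTriHom_treeEquivQDesc K ℕ+
  exact ⟨QuasiShuffle.isNQSh_wordOps, hfree, QuasiShuffle.isTriHom_Omega,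
    QuasiShuffle.Omega_injective,
    hfree.of_equiv _ he fun d => Subtype.ext (QuasiShuffle.Omega_corolla d), _, he,
    QuasiShuffle.coe_treeEquivQDesc K ℕ+⟩
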